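/- Let $(X,g)$ be a compact smooth Riemannian manifold without boundary, $\Delta$ its Laplace–Beltrami operator (with $-\Delta$ self-adjoint and nonnegative on $L^2(X)=L^2(X;\mathbb C)$, with domain $D(-\Delta)$), and let $\omega\subset X$ be open. For $T>0$ and $1\le p\le\infty$, say that the Schrödinger equation is exactly controllable in $L^2$ in time $T$ with controls in $L^p$ if for all $u_0,u_1\in L^2(X)$ there is $h\in L^p((0,T);L^2(X))$ such that the solution $u\in C([0,T];L^2(X))$ of $$i\partial_t u+\Delta u=1_\omega h,\qquad u(0)=u_0,$$ satisfies $u(T)=u_1$. Say that observability holds in time $T$ with constant $C$ if $$\|v_0\|_{L^2}^2\le C\int_0^T\|1_\omega v(t)\|_{L^2}^2\,dt$$ for all $v_0\in L^2(X)$, where $v$ is the solution of $i\partial_t v+\Delta v=0$, $v(0)=v_0$. Say that the resolvent estimate holds with constants $M,m$ if $$\|u\|_{L^2}^2\le M\|(\Delta-\lambda)u\|_{L^2}^2+m\|1_\omega u\|_{L^2}^2\qquad\text{for all }\lambda\in\mathbb R,\ u\in D(-\Delta).$$ 1. For every $p\in[1,\infty]$: the Schrödinger equation is exactly controllable in $L^2$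 in some time $T>0$ with controls in $L^p$ if and only if there exist $M,m>0$ such that the resolvent estimate holds with constants $M,m$. 2. If the resolvent estimate holds with constants $M,m>0$, then for every $T>\pi\sqrt M$ observability holds in time $T$ with constant $C_T=\dfrac{2mT}{T^2-M\pi^2}$, and the equation is exactly controllable in $L^2$ in time $T$ with controls in $L^p$, for every $p\in[1,\infty]$. 3. If observability holds in time $T>0$ with constant $C_T$, then the resolvent estimate holds with constants $M=\dfrac{2C_TT^3}{3}$ and $m=2C_TT$. -/

import Mathlib

open Set Filter Topology MeasureTheory Bundle
open scoped Manifold ContDiff ENNReal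

noncomputable section

namespace Schrodinger

variable {n : ℕ} {X : Type*} [TopologicalSpace X] [ChartedSpace (EuclideanSpace ℝ (Fin n)) X]
  [IsManifold (𝓡 n) ∞ X]

variable (n X) in
/-- Smooth Riemannian metrics on the boundaryless `n`-dimensional smooth manifold `X`. -/
abbrev Metric : Type _ :=
  ContMDiffRiemannianMetric (𝓡 n) ∞ (EuclideanSpace ℝ (Fin n))
    (fun x : X => TangentSpace (𝓡 n) x)

/-- The coordinate vector `∂/∂yᵢ`, for the preferred chart at `x₀`, at the point of `X` with
coordinates `y`. -/
def coordVec (x₀ : X) (y : EuclideanSpace ℝ (Fin n)) (i : Fin n) :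
    TangentSpace (𝓡 n) ((chartAt (EuclideanSpace ℝ (Fin n)) x₀).symm y) :=
  mfderiv (𝓡 n) (𝓡 n) (chartAt (EuclideanSpace ℝ (Fin n)) x₀).symm y
    (EuclideanSpace.single i (1 : ℝ) : EuclideanSpace ℝ (Fin n))

/-- The matrix `g_ij = g(∂/∂yᵢ, ∂/∂yⱼ)` of the metric in the preferred chart at `x₀`, at the point
with coordinates `y`. -/
def metricMatrix (g : Metric n X) (x₀ : X) (y : EuclideanSpace ℝ (Fin n)) :
    Matrix (Fin n) (Fin n) ℝ :=
  Matrix.of fun i j =>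
    g.inner ((chartAt (EuclideanSpace ℝ (Fin n)) x₀).symm y) (coordVec x₀ y i) (coordVec x₀ y j)

section Volume

variable [MeasurableSpace X]

/-- The Riemannian volume of the domain of the preferred chart at `x₀`: the image on `X` of
`√(det g_ij) dy` on the target of the chart. It gives no mass to the complement of that domain. -/
def chartVolume (g : Metric n X) (x₀ : X) : Measure X :=
  Measure.map (chartAt (EuclideanSpace ℝ (Fin n)) x₀).symm
    ((volume.restrict (chartAt (EuclideanSpace ℝ (Fin n)) x₀).target).withDensity
      (fun y => ENNReal.ofReal (Real.sqrt (metricMatrix g x₀ y).det)))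

/-- The Riemannian volume measure of `(X, g)`: the measure which is `√(det g_ij) dy` in each of the
preferred charts. As these local expressions agree on overlaps, and countably many charts cover
the manifold, it is the least measure dominating all of them. -/
def riemVolume (g : Metric n X) : Measure X :=
  ⨆ x₀ : X, chartVolume g x₀

/-- The complex Hilbert space `L²(X)`. -/
abbrev L2 (g : Metric n X) : Type _ := Lp ℂ 2 (riemVolume g)

variable [BorelSpace X]

/-- Multiplication by the indicator function of the open set `U`, on `L²(X)`. -/
def restr (g : Metric n X) (U : TopologicalSpace.Opens X) (u : L2 g) : L2 g :=
  ((Lp.memLp u).indicator U.isOpen.measurableSet).toLp ((U : Set X).indicator u)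

/-- `φ : X → ℂ` is smooth. -/
def Smooth (φ : X → ℂ) : Prop :=
  ContMDiff (𝓡 n) 𝓘(ℝ, ℂ) ∞ φ

/-- The partial derivative at `x` of `φ` along the `i`-th coordinate of the preferred chart
at `x`. -/
def partialDeriv (φ : X → ℂ) (x : X) (i : Fin n) : ℂ :=
  fderiv ℝ (φ ∘ (chartAt (EuclideanSpace ℝ (Fin n)) x).symm)
    (chartAt (EuclideanSpace ℝ (Fin n)) x x) (EuclideanSpace.single i (1 : ℝ))

/-- The Hermitian pairing `⟨∇φ, ∇ψ⟩_g = ∑ g^ij conj(∂ᵢφ) ∂ⱼψ` at `x`, computed in the preferred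
chart at `x` (it does not depend on the chart). -/
def gradInner (g : Metric n X) (φ ψ : X → ℂ) (x : X) : ℂ :=
  ∑ i, ∑ j,
    (((metricMatrix g x (chartAt (EuclideanSpace ℝ (Fin n)) x x))⁻¹ i j : ℝ) : ℂ) *
      (starRingEnd ℂ (partialDeriv φ x i) * partialDeriv ψ x j)

/-- The Dirichlet form `∫ ⟨∇φ, ∇ψ⟩_g dvol` on smooth functions. -/
def dirichlet (g : Metric n X) (φ ψ : X → ℂ) : ℂ :=
  ∫ x, gradInner g φ ψ x ∂(riemVolume g)

/-- The graph of the Laplace-Beltrami operator of `(X, g)` on its `L²` domain: `u` belongs to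
`D(-Δ)` and `Δu = f`. Here `X` is a compact manifold without boundary, and `-Δ` is the nonnegative
self-adjoint operator of the Dirichlet form on `H¹(X)`, the completion of the smooth functions
for the norm `(‖u‖² + ‖∇u‖²)^(1/2)`. So `u` has to be in `H¹(X)`, i.e. an `L²` limit of smooth
functions `φ k` whose gradients form a Cauchy sequence in `L²`, and `Δu = f ∈ L²` means that
`∫ ⟨∇ψ, ∇u⟩_g = - ∫ conj(ψ) f` for all smooth `ψ`, where the left side is
`lim ∫ ⟨∇ψ, ∇(φ k)⟩_g`. -/
def IsLaplacian (g : Metric n X) (u f : L2 g) : Prop :=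
  ∃ φ : ℕ → X → ℂ,
    (∀ k, Smooth (n := n) (φ k)) ∧
    Tendsto (fun k => eLpNorm (fun x => φ k x - u x) 2 (riemVolume g)) atTop (𝓝 0) ∧
    Tendsto (fun p : ℕ × ℕ => dirichlet g (φ p.1 - φ p.2) (φ p.1 - φ p.2)) atTop (𝓝 0) ∧
    ∀ ψ : X → ℂ, Smooth (n := n) ψ →
      Tendsto (fun k => dirichlet g ψ (φ k)) atTop
        (𝓝 (-∫ x, starRingEnd ℂ (ψ x) * f x ∂(riemVolume g)))

/-- `u ∈ C([0,T], L²)` is the solution on `[0,T]` of `i ∂ₜu + Δu = F`, `u(0) = u₀`, in the weak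
sense: for every `φ ∈ D(-Δ)`, the function `t ↦ ⟨φ, u(t)⟩` (antilinear in `φ`) has derivative
`i ⟨Δφ, u(t)⟩ - i ⟨φ, F(t)⟩`, in integrated form. -/
structure IsSolution (g : Metric n X) (T : ℝ) (F : ℝ → L2 g) (u₀ : L2 g) (u : ℝ → L2 g) :
    Prop where
  continuousOn : ContinuousOn u (Icc 0 T)
  initial : u 0 = u₀
  equation : ∀ φ ψ : L2 g, IsLaplacian g φ ψ → ∀ t ∈ Icc (0 : ℝ) T,
    inner ℂ φ (u t) = inner ℂ φ u₀ +
      ∫ s in (0 : ℝ)..t, (Complex.I * inner ℂ ψ (u s) - Complex.I * inner ℂ φ (F s))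

/-- Exact controllability in `L²(X)` in time `T`, with controls in `L^p((0,T), L²(X))` acting
on `U`: every `u₀` is steered to every `u₁` by the equation `i ∂ₜu + Δu = 1_U h`. -/
def ExactlyControllable (g : Metric n X) (U : TopologicalSpace.Opens X) (p : ℝ≥0∞) (T : ℝ) :
    Prop :=
  ∀ u₀ u₁ : L2 g, ∃ h : ℝ → L2 g,
    MemLp h p (volume.restrict (Icc 0 T)) ∧
    ∃ u : ℝ → L2 g, IsSolution g T (fun t => restr g U (h t)) u₀ u ∧ u T = u₁

/-- The observability estimate in time `T` with constant `C`:
`‖v₀‖² ≤ C ∫₀ᵀ ‖1_U v(t)‖² dt` for the solutions of `i ∂ₜv + Δv = 0`, `v(0) = v₀`. -/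
def Observable (g : Metric n X) (U : TopologicalSpace.Opens X) (T C : ℝ) : Prop :=
  ∀ (v₀ : L2 g) (v : ℝ → L2 g), IsSolution g T (fun _ => 0) v₀ v →
    ‖v₀‖ ^ 2 ≤ C * ∫ t in (0 : ℝ)..T, ‖restr g U (v t)‖ ^ 2

/-- The resolvent estimate with constants `M`, `m`:
`‖u‖² ≤ M ‖(Δ - λ)u‖² + m ‖1_U u‖²` for all real `λ` and all `u ∈ D(-Δ)`; `f` stands for `Δu`. -/
def ResolventEstimate (g : Metric n X) (U : TopologicalSpace.Opens X) (M m : ℝ) : Prop :=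
  ∀ (l : ℝ) (u f : L2 g), IsLaplacian g u f →
    ‖u‖ ^ 2 ≤ M * ‖f - (l : ℂ) • u‖ ^ 2 + m * ‖restr g U u‖ ^ 2

end Volume

end Schrodinger

end

/-! The geometry enters only through two facts: the Laplacian `A` is self-adjoint and nonpositive on
a separable Hilbert space, and multiplication by the indicator is a self-adjoint contraction `P`.
With `S t = exp (i t A)`, everything reduces to four implications.

Resolvent estimate to observability (`IsFlow.observable_of_resolventEstimate`): the cutoff orbit `w
t = sin (π t / T) • S t x` vanishes at both ends of `[0, T]`, so integration by parts shows that its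
Fourier coefficients satisfy `(A - 2πk/T) w_k = c_k`, where `c_k` is the coefficient of `(π / T) cos
(π t / T) • i S t x`. Applying the estimate at `λ = 2πk/T` and summing by Parseval gives `T/2 ‖x‖² ≤
M (π/T)² T/2 ‖x‖² + m ∫ ‖P S t x‖²`, which is the stated constant as soon as `T² > M π²`.

Observability to resolvent estimate (`IsFlow.resolventEstimate_of_observable`): if `r = (A - λ) u`,
then `exp (-iλt) S t u` stays within `t ‖r‖` of `u`, and integrating in time gives the constants.

Observability to control (`IsFlow.exists_control`): observability is coercivity of the Gramian `∫ S
(-t) P² S t`, which is therefore invertible; the resulting control `P S t x` is continuous, hence in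
every `L^p`.

Control to resolvent estimate (`exists_resolventEstimate_of_controllable`): the vectors `u` with
`‖(A - λ) u‖ ≤ 1` and `‖P u‖ ≤ 1` for some `λ` are weakly bounded, because pairing `u` with a
controlled trajectory solves a scalar equation with a bound free of `λ`. Banach–Steinhaus makes them
norm bounded.

The remaining work supplies the facts used: self-adjointness from the Dirichlet form
(`nonposSelfAdjoint_formGraph`), the unitary group (`NonposSelfAdjoint.exists_flow`), and the
identification of weak solutions with its orbits (`IsFlow.isWeakSolution`,
`IsFlow.eq_of_isWeakSolution`). -/

namespace Schrodinger

open TopologicalSpace (SeparableSpace)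

/-! ### Stone's theorem by Yosida approximation -/

section AbstractFlow

variable {H : Type*} [NormedAddCommGroup H] [InnerProductSpace ℂ H]

/-- `A` is the graph of a densely defined nonpositive self-adjoint operator. -/
structure NonposSelfAdjoint (A : H → H → Prop) : Prop where
  add : ∀ {u f v k}, A u f → A v k → A (u + v) (f + k)
  smul : ∀ {u f} (c : ℂ), A u f → A (c • u) (c • f)
  symm : ∀ {u f v k}, A u f → A v k → inner ℂ f v = inner ℂ u k
  nonpos : ∀ {u f}, A u f → (inner ℂ u f).re ≤ 0
  surj : ∀ c : ℝ, 0 < c → ∀ x, ∃ u, A u ((c : ℂ) • u - x)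
  dense : ∀ x, (∀ u f, A u f → inner ℂ u x = 0) → x = 0

namespace NonposSelfAdjoint

variable {A : H → H → Prop}

theorem sub (hA : NonposSelfAdjoint A) {u f v k : H} (h : A u f) (h' : A v k) :
    A (u - v) (f - k) := by
  simpa [sub_eq_add_neg] using hA.add h (hA.smul (-1) h')

theorem norm_le (hA : NonposSelfAdjoint A) {c : ℝ} {u x : H}
    (h : A u ((c : ℂ) • u - x)) : c * ‖u‖ ≤ ‖x‖ := by
  have h1 := hA.nonpos h
  rw [inner_sub_right, inner_smul_right, inner_self_eq_norm_sq_to_K] at h1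
  have h2 : (inner ℂ u x).re ≤ ‖u‖ * ‖x‖ := (Complex.re_le_norm _).trans (norm_inner_le_norm _ _)
  have h3 : c * ‖u‖ ^ 2 ≤ ‖u‖ * ‖x‖ := by
    have : (((c : ℂ) * ((‖u‖ : ℂ)) ^ 2 - inner ℂ u x)).re = c * ‖u‖ ^ 2 - (inner ℂ u x).re := by
      rw [Complex.sub_re, ← Complex.ofReal_pow, ← Complex.ofReal_mul, Complex.ofReal_re]
    have h1' : c * ‖u‖ ^ 2 - (inner ℂ u x).re ≤ 0 := this ▸ h1
    linarith
  rcases (norm_nonneg u).eq_or_lt with h0 | h0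
  · rw [← h0]; simp
  · nlinarith

theorem unique (hA : NonposSelfAdjoint A) {c : ℝ} (hc : 0 < c) {u v x : H}
    (h : A u ((c : ℂ) • u - x)) (h' : A v ((c : ℂ) • v - x)) : u = v := by
  have h1 : A (u - v) ((c : ℂ) • (u - v) - 0) := by
    have := hA.sub h h'
    rwa [show (c : ℂ) • u - x - ((c : ℂ) • v - x) = (c : ℂ) • (u - v) - 0 by
      rw [smul_sub]; abel] at this
  have h2 := hA.norm_le h1
  rw [norm_zero] at h2
  have : ‖u - v‖ ≤ 0 := by
    by_contra hcon
    push Not at hcon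
    nlinarith
  exact sub_eq_zero.1 (norm_le_zero_iff.1 this)

/-- An operator whose graph is `NonposSelfAdjoint` contains its adjoint. -/
theorem mem_of_adjoint (hA : NonposSelfAdjoint A) {u F : H}
    (h : ∀ φ ψ, A φ ψ → inner ℂ ψ u = inner ℂ φ F) : A u F := by
  -- The solution `v` of `v - A v = u - F` must be `u`: the difference `u - v` is orthogonal to the
  -- range of `1 - A`, which is everything.
  obtain ⟨v, hv⟩ := hA.surj 1 one_pos (u - F)
  have key : u - v = 0 := by
    obtain ⟨w, hw⟩ := hA.surj 1 one_pos (u - v)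
    have h1 := h _ _ hw
    have h2 := hA.symm hw hv
    rw [← inner_self_eq_zero (𝕜 := ℂ)]
    simp only [Complex.ofReal_one, one_smul, inner_sub_left, inner_sub_right] at h1 h2 ⊢
    linear_combination h2 - h1
  rw [sub_eq_zero] at key
  subst key
  simpa using hv

/-- The resolvent `(c - A)⁻¹`, for `c > 0`. -/
noncomputable def resolvent (hA : NonposSelfAdjoint A) {c : ℝ} (hc : 0 < c) : H →L[ℂ] H :=
  LinearMap.mkContinuous
    { toFun := fun x => (hA.surj c hc x).choose
      map_add' := fun x y => by
        refine hA.unique hc (hA.surj c hc (x + y)).choose_spec ?_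
        have := hA.add (hA.surj c hc x).choose_spec (hA.surj c hc y).choose_spec
        rwa [← add_sub_add_comm, ← smul_add] at this
      map_smul' := fun a x => by
        refine hA.unique hc (hA.surj c hc (a • x)).choose_spec ?_
        have := hA.smul a (hA.surj c hc x).choose_spec
        rwa [smul_sub, smul_comm] at this }
    c⁻¹ (fun x => by
      rw [inv_mul_eq_div, le_div_iff₀' hc]
      exact hA.norm_le (hA.surj c hc x).choose_spec)

theorem resolvent_mem (hA : NonposSelfAdjoint A) {c : ℝ} (hc : 0 < c) (x : H) :
    A (hA.resolvent hc x) ((c : ℂ) • hA.resolvent hc x - x) :=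
  (hA.surj c hc x).choose_spec

theorem resolvent_eq (hA : NonposSelfAdjoint A) {c : ℝ} (hc : 0 < c) {u x : H}
    (h : A u ((c : ℂ) • u - x)) : hA.resolvent hc x = u :=
  hA.unique hc (hA.resolvent_mem hc x) h

theorem norm_resolvent_le (hA : NonposSelfAdjoint A) {c : ℝ} (hc : 0 < c) (x : H) :
    ‖(c : ℂ) • hA.resolvent hc x‖ ≤ ‖x‖ := by
  rw [norm_smul, Complex.norm_real, Real.norm_of_nonneg hc.le]
  exact hA.norm_le (hA.resolvent_mem hc x)

theorem inner_resolvent (hA : NonposSelfAdjoint A) {c : ℝ} (hc : 0 < c) (x y : H) :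
    inner ℂ (hA.resolvent hc x) y = inner ℂ x (hA.resolvent hc y) := by
  have := hA.symm (hA.resolvent_mem hc x) (hA.resolvent_mem hc y)
  simp only [inner_sub_left, inner_sub_right, inner_smul_left, inner_smul_right,
    Complex.conj_ofReal] at this
  linear_combination this

/-- The resolvent identity `(a - b) R_a R_b = R_b - R_a`, used in both orders; division by `c - d`
is why equal parameters are treated apart. -/
theorem resolvent_comm (hA : NonposSelfAdjoint A) {c d : ℝ} (hc : 0 < c) (hd : 0 < d) :
    Commute (hA.resolvent hc) (hA.resolvent hd) := by
  rcases eq_or_ne c d with rfl | hcd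
  · exact Commute.refl _
  have key : ∀ {a b : ℝ} (ha : 0 < a) (hb : 0 < b) (x : H),
      hA.resolvent ha x + ((a - b : ℝ) : ℂ) • hA.resolvent ha (hA.resolvent hb x) =
        hA.resolvent hb x := by
    intro a b ha hb x
    rw [← map_smul, ← map_add]
    apply hA.resolvent_eq
    have := hA.resolvent_mem hb x
    convert this using 1
    push_cast
    module
  ext x
  have h1 := key hc hd x
  have h2 := key hd hc x
  have h3 : ((c - d : ℝ) : ℂ) ≠ 0 := by
    exact_mod_cast sub_ne_zero.2 hcd
  apply smul_right_injective H h3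
  simp only [mul_apply_eq_comp]
  have e1 := eq_sub_of_add_eq' h1
  have e2 := eq_sub_of_add_eq' h2
  rw [e1, ← neg_sub d c, Complex.ofReal_neg, neg_smul, e2]
  abel

/-- The domain is dense. -/
theorem dense_domain [CompleteSpace H] (hA : NonposSelfAdjoint A) :
    Dense {u : H | ∃ f, A u f} := by
  have h0 : A 0 0 := by
    obtain ⟨u, hu⟩ := hA.surj 1 one_pos 0
    simpa using hA.smul 0 hu
  let D : Submodule ℂ H :=
    { carrier := {u : H | ∃ f, A u f}
      add_mem' := fun ⟨f, hf⟩ ⟨k, hk⟩ => ⟨_, hA.add hf hk⟩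
      zero_mem' := ⟨0, h0⟩
      smul_mem' := fun c _ ⟨f, hf⟩ => ⟨_, hA.smul c hf⟩ }
  have hD : Dᗮ = ⊥ := by
    rw [Submodule.eq_bot_iff]
    intro x hx
    exact hA.dense x fun u f h => hx u ⟨f, h⟩
  exact Submodule.dense_iff_topologicalClosure_eq_top.2
    (Submodule.topologicalClosure_eq_top_iff.2 hD)

/-- The Yosida approximation `c A (c - A)⁻¹` of `A`. -/
noncomputable def yosida (hA : NonposSelfAdjoint A) {c : ℝ} (hc : 0 < c) : H →L[ℂ] H :=
  (c : ℂ) • ((c : ℂ) • hA.resolvent hc - 1)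

theorem yosida_comm (hA : NonposSelfAdjoint A) {c d : ℝ} (hc : 0 < c) (hd : 0 < d) :
    Commute (hA.yosida hc) (hA.yosida hd) := by
  unfold yosida
  refine Commute.smul_left (Commute.smul_right ?_ _) _
  refine Commute.sub_left (Commute.sub_right ?_ (Commute.one_right _)) (Commute.one_left _)
  exact Commute.smul_left (Commute.smul_right (hA.resolvent_comm hc hd) _) _

theorem inner_yosida (hA : NonposSelfAdjoint A) {c : ℝ} (hc : 0 < c) (x y : H) :
    inner ℂ (hA.yosida hc x) y = inner ℂ x (hA.yosida hc y) := by
  simp only [yosida, smul_apply, sub_apply, one_apply_eq_self, inner_sub_left, inner_sub_right,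
    inner_smul_left, inner_smul_right, Complex.conj_ofReal, hA.inner_resolvent hc]

theorem yosida_apply (hA : NonposSelfAdjoint A) {c : ℝ} (hc : 0 < c) {x f : H} (h : A x f) :
    hA.yosida hc x = (c : ℂ) • hA.resolvent hc f := by
  have h1 : hA.resolvent hc ((c : ℂ) • x - f) = x := by
    apply hA.resolvent_eq
    simpa using h
  rw [map_sub, map_smul] at h1
  simp only [yosida, smul_apply, sub_apply, one_apply_eq_self]
  congr 1
  rw [sub_eq_iff_eq_add] at h1 ⊢
  rw [h1, add_comm]

/-- On the domain, `c R_c z - z = R_c (A z)` has norm at most `‖A z‖ / c`; the contraction bound on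
`c R_c` and density extend the limit to every `x`. -/
theorem tendsto_resolvent [CompleteSpace H] (hA : NonposSelfAdjoint A) (x : H) :
    Tendsto (fun n : ℕ => (((n + 1 : ℕ) : ℝ) : ℂ) •
      hA.resolvent (c := ((n + 1 : ℕ) : ℝ)) (by positivity) x) atTop (𝓝 x) := by
  rw [Metric.tendsto_atTop]
  intro ε hε
  obtain ⟨z, hzx, f, hz⟩ := Metric.dense_iff.1 hA.dense_domain x (ε / 3) (by positivity)
  obtain ⟨N, hN⟩ := exists_nat_gt (‖f‖ / (ε / 3))
  refine ⟨N, fun n hn => ?_⟩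
  set c : ℝ := ((n + 1 : ℕ) : ℝ) with hcdef
  have hc : 0 < c := by positivity
  have hNc : ‖f‖ / (ε / 3) < c := hN.trans (by rw [hcdef]; exact_mod_cast Nat.lt_succ_of_le hn)
  have hfz : (c : ℂ) • hA.resolvent hc z - z = hA.resolvent hc f := by
    have h1 : hA.resolvent hc ((c : ℂ) • z - f) = z := by
      apply hA.resolvent_eq
      simpa using hz
    rw [map_sub, map_smul] at h1
    rw [sub_eq_iff_eq_add] at h1 ⊢
    rw [h1, add_comm]
  have hf : ‖hA.resolvent hc f‖ < ε / 3 := by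
    have := hA.norm_le (hA.resolvent_mem hc f)
    rw [div_lt_iff₀ (by positivity)] at hNc
    by_contra hcon
    push Not at hcon
    nlinarith
  have hzx' : ‖z - x‖ < ε / 3 := by simpa [dist_eq_norm] using hzx
  have h3 : ‖(c : ℂ) • hA.resolvent hc (x - z)‖ < ε / 3 :=
    (hA.norm_resolvent_le hc _).trans_lt (by rwa [norm_sub_rev])
  rw [dist_eq_norm]
  have : (c : ℂ) • hA.resolvent hc x - x =
      (c : ℂ) • hA.resolvent hc (x - z) + hA.resolvent hc f + (z - x) := by
    rw [← hfz, map_sub, smul_sub]; abel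
  rw [this]
  calc _ ≤ ‖(c : ℂ) • hA.resolvent hc (x - z)‖ + ‖hA.resolvent hc f‖ + ‖z - x‖ := norm_add₃_le
    _ < ε := by linarith

end NonposSelfAdjoint

section Exponential

variable [CompleteSpace H]

/-- The unitary group `exp (i t B)` generated by a bounded operator `B`. -/
noncomputable def unitaryExp (B : H →L[ℂ] H) (t : ℝ) : H →L[ℂ] H :=
  NormedSpace.exp (t • (Complex.I • B))

theorem unitaryExp_zero (B : H →L[ℂ] H) : unitaryExp B 0 = 1 := by
  simp [unitaryExp, NormedSpace.exp_zero]

theorem unitaryExp_mul {B B' : H →L[ℂ] H} (h : Commute B B') (t : ℝ) :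
    unitaryExp B t * unitaryExp B' t = unitaryExp (B + B') t := by
  let _ : NormedAlgebra ℚ (H →L[ℂ] H) := .restrictScalars ℚ ℝ _
  unfold unitaryExp
  rw [← NormedSpace.exp_add_of_commute, smul_add, smul_add]
  exact Commute.smul_left (Commute.smul_right (Commute.smul_left (Commute.smul_right h _) _) _) _

theorem hasDerivAt_unitaryExp (B : H →L[ℂ] H) (t : ℝ) (x : H) :
    HasDerivAt (fun t => unitaryExp B t x) (Complex.I • unitaryExp B t (B x)) t := by
  have h := hasDerivAt_exp_smul_const (𝕂 := ℝ) (Complex.I • B) t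
  have h2 := (((ContinuousLinearMap.apply ℂ H x).restrictScalars ℝ).hasFDerivAt).comp_hasDerivAt t h
  simpa [unitaryExp, Function.comp_def] using h2

theorem inner_unitaryExp {B : H →L[ℂ] H} (hB : ∀ x y, inner ℂ (B x) y = inner ℂ x (B y))
    (t : ℝ) (x y : H) :
    inner ℂ (unitaryExp B t x) y = inner ℂ x (unitaryExp B (-t) y) := by
  have h1 : star B = B := by
    rw [ContinuousLinearMap.star_eq_adjoint]
    exact ((ContinuousLinearMap.eq_adjoint_iff _ _).2 hB).symm
  have h2 : star (unitaryExp B t) = unitaryExp B (-t) := by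
    rw [unitaryExp, NormedSpace.star_exp, unitaryExp]
    congr 1
    rw [star_smul, star_smul, h1]
    simp
  rw [← h2, ContinuousLinearMap.star_eq_adjoint, ContinuousLinearMap.adjoint_inner_right]

theorem norm_unitaryExp {B : H →L[ℂ] H} (hB : ∀ x y, inner ℂ (B x) y = inner ℂ x (B y))
    (t : ℝ) (x : H) : ‖unitaryExp B t x‖ = ‖x‖ := by
  have h : unitaryExp B (-t) (unitaryExp B t x) = x := by
    have : unitaryExp B (-t) * unitaryExp B t = 1 := by
      have h0 : unitaryExp B (-t) = unitaryExp (-B) t := by simp [unitaryExp]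
      rw [h0, unitaryExp_mul (Commute.neg_left (Commute.refl B)), neg_add_cancel]
      simp [unitaryExp, NormedSpace.exp_zero]
    exact congrArg (fun B : H →L[ℂ] H => B x) this
  have h2 := inner_unitaryExp hB t x (unitaryExp B t x)
  rw [h, inner_self_eq_norm_sq_to_K, inner_self_eq_norm_sq_to_K] at h2
  have h3 : ‖unitaryExp B t x‖ ^ 2 = ‖x‖ ^ 2 := by exact_mod_cast h2
  exact (sq_eq_sq₀ (norm_nonneg _) (norm_nonneg _)).1 h3

theorem norm_unitaryExp_sub_le {B : H →L[ℂ] H} (hB : ∀ x y, inner ℂ (B x) y = inner ℂ x (B y))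
    (s t : ℝ) (x : H) : ‖unitaryExp B t x - unitaryExp B s x‖ ≤ ‖B x‖ * |t - s| := by
  have := Convex.norm_image_sub_le_of_norm_hasDerivWithin_le (𝕜 := ℝ) (s := univ) (x := s) (y := t)
    (fun r _ => (hasDerivAt_unitaryExp B r x).hasDerivWithinAt) (C := ‖B x‖)
    (fun r _ => by rw [norm_smul, Complex.norm_I, one_mul, norm_unitaryExp hB])
    convex_univ (mem_univ _) (mem_univ _)
  simpa using this

/-- Commuting generators allow the factorization `exp (itB) = exp (itB') exp (it(B - B'))`; the
isometry `exp (itB')` then drops out. -/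
theorem norm_unitaryExp_sub_unitaryExp_le {B B' : H →L[ℂ] H}
    (hB : ∀ x y, inner ℂ (B x) y = inner ℂ x (B y))
    (hB' : ∀ x y, inner ℂ (B' x) y = inner ℂ x (B' y)) (hc : Commute B B') (t : ℝ) (x : H) :
    ‖unitaryExp B t x - unitaryExp B' t x‖ ≤ ‖B x - B' x‖ * |t| := by
  have h1 : unitaryExp B t = unitaryExp B' t * unitaryExp (B - B') t := by
    rw [unitaryExp_mul (Commute.sub_right hc.symm (Commute.refl _)), add_sub_cancel]
  have h2 := norm_unitaryExp_sub_le (B := B - B') (fun x y => by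
    simp only [sub_apply, inner_sub_left, inner_sub_right, hB, hB']) 0 t x
  rw [h1, mul_apply_eq_comp, ← map_sub, norm_unitaryExp hB']
  simpa [unitaryExp_zero] using h2

end Exponential

namespace NonposSelfAdjoint

variable {A : H → H → Prop}

/-- The Yosida approximation with parameter `n + 1`. -/
noncomputable def yosidaSeq (hA : NonposSelfAdjoint A) (n : ℕ) : H →L[ℂ] H :=
  hA.yosida (c := ((n + 1 : ℕ) : ℝ)) (by positivity)

theorem norm_yosidaSeq_le (hA : NonposSelfAdjoint A) {x f : H} (h : A x f) (n : ℕ) :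
    ‖hA.yosidaSeq n x‖ ≤ ‖f‖ := by
  rw [yosidaSeq, hA.yosida_apply _ h]
  exact hA.norm_resolvent_le _ f

theorem inner_yosidaSeq (hA : NonposSelfAdjoint A) (n : ℕ) (x y : H) :
    inner ℂ (hA.yosidaSeq n x) y = inner ℂ x (hA.yosidaSeq n y) :=
  hA.inner_yosida _ x y

variable [CompleteSpace H]

theorem tendsto_yosidaSeq (hA : NonposSelfAdjoint A) {x f : H} (h : A x f) :
    Tendsto (fun n => hA.yosidaSeq n x) atTop (𝓝 f) := by
  refine (hA.tendsto_resolvent f).congr fun n => ?_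
  exact (hA.yosida_apply _ h).symm

/-- On the domain, the exponentials are compared through the convergent generators; isometry of each
one carries the Cauchy property to the closure. -/
theorem cauchySeq_unitaryExp (hA : NonposSelfAdjoint A) (t : ℝ) (x : H) :
    CauchySeq fun n => unitaryExp (hA.yosidaSeq n) t x := by
  have hdom : ∀ z f, A z f → CauchySeq fun n => unitaryExp (hA.yosidaSeq n) t z := by
    intro z f h
    have h1 := (hA.tendsto_yosidaSeq h).cauchySeq
    rw [Metric.cauchySeq_iff] at h1 ⊢
    intro ε hε
    obtain ⟨N, hN⟩ := h1 (ε / (|t| + 1)) (by positivity)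
    refine ⟨N, fun m hm n hn => ?_⟩
    have h2 := hN m hm n hn
    rw [dist_eq_norm] at h2 ⊢
    rw [lt_div_iff₀ (by positivity)] at h2
    refine (norm_unitaryExp_sub_unitaryExp_le (hA.inner_yosidaSeq m) (hA.inner_yosidaSeq n)
      (hA.yosida_comm _ _) t z).trans_lt (lt_of_le_of_lt ?_ h2)
    gcongr
    linarith
  rw [Metric.cauchySeq_iff]
  intro ε hε
  obtain ⟨z, hzx, f, hz⟩ := Metric.dense_iff.1 hA.dense_domain x (ε / 3) (by positivity)
  obtain ⟨N, hN⟩ := Metric.cauchySeq_iff.1 (hdom z f hz) (ε / 3) (by positivity)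
  have hzx' : dist z x < ε / 3 := hzx
  have hd : ∀ n, dist (unitaryExp (hA.yosidaSeq n) t z) (unitaryExp (hA.yosidaSeq n) t x) < ε / 3 :=
    fun n => by
      rwa [dist_eq_norm, ← map_sub, norm_unitaryExp (hA.inner_yosidaSeq n), ← dist_eq_norm]
  refine ⟨N, fun m hm n hn => ?_⟩
  have h1 := hN m hm n hn
  calc _ ≤ dist (unitaryExp (hA.yosidaSeq m) t x) (unitaryExp (hA.yosidaSeq m) t z) +
        dist (unitaryExp (hA.yosidaSeq m) t z) (unitaryExp (hA.yosidaSeq n) t z) +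
        dist (unitaryExp (hA.yosidaSeq n) t z) (unitaryExp (hA.yosidaSeq n) t x) :=
        dist_triangle4 _ _ _ _
    _ < ε := by rw [dist_comm (unitaryExp (hA.yosidaSeq m) t x)]; linarith [hd m, hd n]

/-- **Stone's theorem**, for nonpositive operators. -/
theorem exists_flow (hA : NonposSelfAdjoint A) :
    ∃ S : ℝ → H →L[ℂ] H, S 0 = 1 ∧ (∀ t x, ‖S t x‖ = ‖x‖) ∧
      (∀ t x y, inner ℂ (S t x) y = inner ℂ x (S (-t) y)) ∧
      (∀ x, Continuous fun t => S t x) ∧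
      ∀ φ ψ, A φ ψ → ∀ t, HasDerivAt (fun t => S t φ) (Complex.I • S t ψ) t := by
  choose L hL using fun t x => cauchySeq_tendsto_of_complete (hA.cauchySeq_unitaryExp t x)
  have hnorm : ∀ t x, ‖L t x‖ = ‖x‖ := fun t x =>
    tendsto_nhds_unique (hL t x).norm (by
      simp only [norm_unitaryExp (hA.inner_yosidaSeq _)]
      exact tendsto_const_nhds)
  let S : ℝ → H →L[ℂ] H := fun t => LinearMap.mkContinuous
    { toFun := L t
      map_add' := fun x y => tendsto_nhds_unique (hL t (x + y)) (by
        simpa using (hL t x).add (hL t y))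
      map_smul' := fun c x => tendsto_nhds_unique (hL t (c • x)) (by
        simpa using (hL t x).const_smul c) } 1 (fun x => by simp [hnorm])
  have hS : ∀ t x, Tendsto (fun n => unitaryExp (hA.yosidaSeq n) t x) atTop (𝓝 (S t x)) := hL
  have hSnorm : ∀ t x, ‖S t x‖ = ‖x‖ := hnorm
  have hlip : ∀ x f, A x f → ∀ s t, dist (S t x) (S s x) ≤ ‖f‖ * |t - s| := by
    intro x f h s t
    rw [dist_eq_norm]
    refine le_of_tendsto ((hS t x).sub (hS s x)).norm (Eventually.of_forall fun n => ?_)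
    refine (norm_unitaryExp_sub_le (hA.inner_yosidaSeq n) s t x).trans ?_
    gcongr
    exact hA.norm_yosidaSeq_le h n
  have hcont : ∀ x, Continuous fun t => S t x := by
    intro x
    rw [Metric.continuous_iff]
    intro s ε hε
    obtain ⟨z, hzx, f, hz⟩ := Metric.dense_iff.1 hA.dense_domain x (ε / 3) (by positivity)
    have hzx' : dist z x < ε / 3 := hzx
    have hd : ∀ t, dist (S t z) (S t x) < ε / 3 := fun t => by
      rwa [dist_eq_norm, ← map_sub, hSnorm, ← dist_eq_norm]
    refine ⟨ε / 3 / (‖f‖ + 1), by positivity, fun t ht => ?_⟩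
    rw [Real.dist_eq, lt_div_iff₀ (by positivity)] at ht
    have h1 := hlip z f hz s t
    have h2 : ‖f‖ * |t - s| ≤ |t - s| * (‖f‖ + 1) := by nlinarith [abs_nonneg (t - s)]
    calc _ ≤ dist (S t x) (S t z) + dist (S t z) (S s z) + dist (S s z) (S s x) :=
          dist_triangle4 _ _ _ _
      _ < ε := by rw [dist_comm (S t x)]; linarith [hd t, hd s]
  refine ⟨S, ?_, hSnorm, ?_, hcont, ?_⟩
  · ext x
    refine tendsto_nhds_unique (hS 0 x) ?_
    simp only [unitaryExp_zero]
    exact tendsto_const_nhds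
  · intro t x y
    refine tendsto_nhds_unique ((hS t x).inner tendsto_const_nhds) ?_
    simp only [inner_unitaryExp (hA.inner_yosidaSeq _)]
    exact tendsto_const_nhds.inner (hS (-t) y)
  · intro φ ψ h t
    -- Derivatives do not pass to the limit directly, so the limit is taken in the integrated
    -- equation; `‖A_n φ‖ ≤ ‖A φ‖` dominates the integrands.
    have hint : ∀ t, S t φ = φ + ∫ s in (0 : ℝ)..t, Complex.I • S s ψ := by
      intro t
      have h1 : ∀ n, unitaryExp (hA.yosidaSeq n) t φ = φ + ∫ s in (0 : ℝ)..t,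
          Complex.I • unitaryExp (hA.yosidaSeq n) s (hA.yosidaSeq n φ) := by
        intro n
        have hc : Continuous fun s => Complex.I •
            unitaryExp (hA.yosidaSeq n) s (hA.yosidaSeq n φ) :=
          (continuous_iff_continuousAt.2 fun s =>
            (hasDerivAt_unitaryExp (hA.yosidaSeq n) s (hA.yosidaSeq n φ)).continuousAt).const_smul _
        rw [intervalIntegral.integral_eq_sub_of_hasDerivAt
          (fun s _ => hasDerivAt_unitaryExp (hA.yosidaSeq n) s φ) (hc.intervalIntegrable _ _),
          unitaryExp_zero]
        simp
      refine tendsto_nhds_unique (hS t φ) ?_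
      simp only [h1]
      refine tendsto_const_nhds.add ?_
      refine intervalIntegral.tendsto_integral_filter_of_dominated_convergence (fun _ => ‖ψ‖)
        (Eventually.of_forall fun n => ?_) (Eventually.of_forall fun n => ?_)
        intervalIntegrable_const (Eventually.of_forall fun s _ => ?_)
      · exact ((continuous_iff_continuousAt.2 fun s =>
            (hasDerivAt_unitaryExp (hA.yosidaSeq n) s (hA.yosidaSeq n φ)).continuousAt).const_smul
            _).aestronglyMeasurable
      · refine Eventually.of_forall fun s _ => ?_
        rw [norm_smul, Complex.norm_I, one_mul, norm_unitaryExp (hA.inner_yosidaSeq n)]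
        exact hA.norm_yosidaSeq_le h n
      · refine Tendsto.const_smul ?_ _
        have h2 : Tendsto (fun n => unitaryExp (hA.yosidaSeq n) s (hA.yosidaSeq n φ - ψ))
            atTop (𝓝 0) := by
          rw [tendsto_zero_iff_norm_tendsto_zero]
          simp only [norm_unitaryExp (hA.inner_yosidaSeq _)]
          rw [← tendsto_zero_iff_norm_tendsto_zero]
          simpa using (hA.tendsto_yosidaSeq h).sub_const ψ
        simpa using h2.add (hS s ψ)
    have hc : Continuous fun s => Complex.I • S s ψ := (hcont ψ).const_smul _
    rw [show (fun t => S t φ) = fun t => φ + ∫ s in (0 : ℝ)..t, Complex.I • S s ψ from funext hint]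
    exact (intervalIntegral.integral_hasDerivAt_right (hc.intervalIntegrable _ _)
      (hc.stronglyMeasurableAtFilter _ _) hc.continuousAt).const_add _

end NonposSelfAdjoint

end AbstractFlow

/-! ### Vector-valued Parseval and weak solutions of the evolution equation -/

section AbstractEvolution

variable {H : Type*} [NormedAddCommGroup H] [InnerProductSpace ℂ H]

theorem _root_.HilbertBasis.hasSum_norm_inner_sq {ι : Type*} (b : HilbertBasis ι ℂ H) (x : H) :
    HasSum (fun i => ‖(inner ℂ (b i) x : ℂ)‖ ^ 2) (‖x‖ ^ 2) := by
  have h := (b.hasSum_inner_mul_inner x x).mapL Complex.reCLM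
  have h2 : Complex.reCLM (inner ℂ x x) = ‖x‖ ^ 2 := by
    rw [Complex.reCLM_apply, inner_self_eq_norm_sq_to_K]; norm_cast
  rw [h2] at h
  convert h using 2 with i
  rw [Complex.reCLM_apply, ← inner_conj_symm x (b i), Complex.conj_mul']
  norm_cast

/-- An orthonormal set in a separable space is countable. -/
theorem _root_.Orthonormal.countable_of_separable [SeparableSpace H] {w : Set H}
    (hw : Orthonormal ℂ ((↑) : w → H)) : w.Countable := by
  -- Orthonormal vectors are at distance `√2`, so balls of radius `1 / 2` around them are disjoint.
  refine Set.PairwiseDisjoint.countable_of_isOpen (s := fun x : H => Metric.ball x (1 / 2))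
    (fun x hx y hy hxy => ?_) (fun _ _ => Metric.isOpen_ball)
    (fun x _ => Metric.nonempty_ball.2 (by norm_num))
  refine Metric.ball_disjoint_ball ?_
  have h1 : ‖x‖ = 1 := hw.1 ⟨x, hx⟩
  have h2 : ‖y‖ = 1 := hw.1 ⟨y, hy⟩
  have h3 : inner ℂ x y = 0 := hw.2 (i := ⟨x, hx⟩) (j := ⟨y, hy⟩) (by simpa using hxy)
  have h4 := norm_sub_sq (𝕜 := ℂ) x y
  rw [h1, h2, h3] at h4
  rw [dist_eq_norm]
  norm_num at h4 ⊢
  nlinarith [norm_nonneg (x - y)]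

section Parseval

variable [CompleteSpace H]

theorem _root_.ContinuousLinearMap.map_fourierCoeffOn {E : Type*} [NormedAddCommGroup E]
    [NormedSpace ℂ E] [CompleteSpace E] (L : H →L[ℂ] E) {a b : ℝ} (hab : a < b) {f : ℝ → H}
    (hf : ContinuousOn f (Icc a b)) (k : ℤ) :
    L (fourierCoeffOn hab f k) = fourierCoeffOn hab (fun t => L (f t)) k := by
  have hc : ContinuousOn (fun t : ℝ => fourier (-k) (t : AddCircle (b - a)) • f t) (uIcc a b) := by
    rw [uIcc_of_le hab.le]
    refine ContinuousOn.smul (Continuous.continuousOn ?_) hf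
    exact (fourier (T := b - a) (-k)).continuous.comp (AddCircle.continuous_mk' _)
  rw [fourierCoeffOn_eq_integral, fourierCoeffOn_eq_integral, ← Complex.coe_smul, map_smul,
    ← L.intervalIntegral_comp_comm (hc.intervalIntegrable (μ := volume)), Complex.coe_smul]
  simp only [map_smul]

theorem inner_fourierCoeffOn {a b : ℝ} (hab : a < b) {f : ℝ → H} (hf : ContinuousOn f (Icc a b))
    (x : H) (k : ℤ) :
    inner ℂ x (fourierCoeffOn hab f k) = fourierCoeffOn hab (fun t => inner ℂ x (f t)) k :=
  (innerSL ℂ x).map_fourierCoeffOn hab hf k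

/-- **Parseval's identity** for functions with values in a separable Hilbert space. -/
theorem hasSum_norm_sq_fourierCoeffOn [SeparableSpace H] {a b : ℝ} (hab : a < b) {f : ℝ → H}
    (hf : ContinuousOn f (Icc a b)) :
    HasSum (fun k => ‖fourierCoeffOn hab f k‖ ^ 2) ((b - a)⁻¹ * ∫ x in a..b, ‖f x‖ ^ 2) := by
  -- Scalar Parseval is applied to each coordinate in a Hilbert basis. The sums are exchanged in
  -- `ℝ≥0∞`, where no summability is needed; countability of the basis is needed to exchange sum and
  -- integral.
  obtain ⟨w, e, he⟩ := exists_hilbertBasis ℂ H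
  have hw : Countable w := by
    have h := e.orthonormal
    rw [he] at h
    exact h.countable_of_separable.to_subtype
  have hba : 0 < (b - a)⁻¹ := by simpa using hab
  have hnorm : ∀ x : H, ENNReal.ofReal (‖x‖ ^ 2) =
      ∑' i, ENNReal.ofReal (‖(inner ℂ (e i) x : ℂ)‖ ^ 2) := fun x => by
    rw [← ENNReal.ofReal_tsum_of_nonneg (fun i => by positivity)
      (e.hasSum_norm_inner_sq x).summable, (e.hasSum_norm_inner_sq x).tsum_eq]
  have hfi : ∀ i, ContinuousOn (fun t => (inner ℂ (e i) (f t) : ℂ)) (Icc a b) := fun i =>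
    continuousOn_const.inner hf
  have hlin : ∀ g : ℝ → ℂ, ContinuousOn g (Icc a b) →
      ENNReal.ofReal (∫ x in a..b, ‖g x‖ ^ 2) =
        ∫⁻ x in Ioc a b, ENNReal.ofReal (‖g x‖ ^ 2) := fun g hg => by
    rw [intervalIntegral.integral_of_le hab.le, ofReal_integral_eq_lintegral_ofReal]
    · exact ((hg.norm.pow 2).integrableOn_Icc).mono_set Ioc_subset_Icc_self
    · exact Eventually.of_forall fun x => by positivity
  have hsum : ∑' k, ENNReal.ofReal (‖fourierCoeffOn hab f k‖ ^ 2) =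
      ENNReal.ofReal ((b - a)⁻¹ * ∫ x in a..b, ‖f x‖ ^ 2) := by
    have hpars : ∀ i, ∑' k, ENNReal.ofReal
          (‖fourierCoeffOn hab (fun t => (inner ℂ (e i) (f t) : ℂ)) k‖ ^ 2) =
        ENNReal.ofReal ((b - a)⁻¹ * ∫ x in a..b, ‖(inner ℂ (e i) (f x) : ℂ)‖ ^ 2) := fun i => by
      have h := hasSum_sq_fourierCoeffOn hab (f := fun t => (inner ℂ (e i) (f t) : ℂ)) (by
        refine MemLp.mono_measure (Measure.restrict_mono Ioc_subset_Icc_self le_rfl) ?_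
        obtain ⟨C, hC⟩ := isCompact_Icc.exists_bound_of_continuousOn (hfi i)
        exact MemLp.of_bound ((hfi i).aestronglyMeasurable measurableSet_Icc) C
          ((ae_restrict_iff' measurableSet_Icc).2 (Eventually.of_forall hC)))
      rw [← ENNReal.ofReal_tsum_of_nonneg (fun i => by positivity) h.summable, h.tsum_eq,
        smul_eq_mul]
    simp_rw [hnorm (fourierCoeffOn hab f _), inner_fourierCoeffOn hab hf]
    rw [ENNReal.tsum_comm]
    simp_rw [hpars, ENNReal.ofReal_mul hba.le, hlin _ (hfi _)]
    rw [ENNReal.tsum_mul_left, ← lintegral_tsum]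
    · congr 1
      simp_rw [← hnorm]
      rw [intervalIntegral.integral_of_le hab.le, ofReal_integral_eq_lintegral_ofReal]
      · exact ((hf.norm.pow 2).integrableOn_Icc).mono_set Ioc_subset_Icc_self
      · exact Eventually.of_forall fun x => by positivity
    · intro i
      refine AEMeasurable.ennreal_ofReal ?_
      exact (((hfi i).norm.pow 2).mono Ioc_subset_Icc_self).aemeasurable measurableSet_Ioc
  have h1 := ENNReal.hasSum_toReal (hsum.trans_ne ENNReal.ofReal_ne_top)
  rw [← ENNReal.tsum_toReal_eq (fun k => ENNReal.ofReal_ne_top), hsum, ENNReal.toReal_ofReal] at h1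
  · simpa only [ENNReal.toReal_ofReal (sq_nonneg _)] using h1
  · refine mul_nonneg hba.le (intervalIntegral.integral_nonneg hab.le fun x _ => by positivity)

end Parseval

/-- The unitary group `exp (i t A)`. -/
structure IsFlow (A : H → H → Prop) (S : ℝ → H →L[ℂ] H) : Prop where
  zero : S 0 = 1
  norm_apply : ∀ t x, ‖S t x‖ = ‖x‖
  inner_apply : ∀ t x y, inner ℂ (S t x) y = inner ℂ x (S (-t) y)
  continuous : ∀ x, Continuous fun t => S t x
  hasDerivAt : ∀ {φ ψ}, A φ ψ → ∀ t, HasDerivAt (fun t => S t φ) (Complex.I • S t ψ) t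

theorem NonposSelfAdjoint.exists_isFlow [CompleteSpace H] {A : H → H → Prop}
    (hA : NonposSelfAdjoint A) : ∃ S, IsFlow A S :=
  let ⟨S, h0, h1, h2, h3, h4⟩ := hA.exists_flow
  ⟨S, h0, h1, h2, h3, h4 _ _⟩

/-- No group law is at hand: isometry and the adjoint relation make `‖S (-t) (S t x) - x‖²` expand
to zero. -/
theorem IsFlow.neg_apply {A : H → H → Prop} {S : ℝ → H →L[ℂ] H} (hS : IsFlow A S) (t : ℝ)
    (x : H) : S (-t) (S t x) = x := by
  have h1 := hS.inner_apply t x (S t x)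
  have h2 := hS.norm_apply (-t) (S t x)
  rw [hS.norm_apply t] at h2
  rw [← sub_eq_zero, ← norm_eq_zero, ← sq_eq_zero_iff, norm_sub_sq (𝕜 := ℂ), h2,
    inner_re_symm, ← h1, inner_self_eq_norm_sq, hS.norm_apply]
  ring

/-- Strong continuity at a fixed vector suffices because every `S t` is an isometry. -/
theorem IsFlow.continuous_apply {A : H → H → Prop} {S : ℝ → H →L[ℂ] H} (hS : IsFlow A S)
    {σ : ℝ → ℝ} {F : ℝ → H} (hσ : Continuous σ) (hF : Continuous F) :
    Continuous fun t => S (σ t) (F t) := by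
  rw [continuous_iff_continuousAt]
  intro t
  rw [ContinuousAt, tendsto_iff_norm_sub_tendsto_zero]
  have h1 : Tendsto (fun s => ‖F s - F t‖) (𝓝 t) (𝓝 0) :=
    tendsto_iff_norm_sub_tendsto_zero.1 hF.continuousAt
  have h2 : Tendsto (fun s => ‖S (σ s) (F t) - S (σ t) (F t)‖) (𝓝 t) (𝓝 0) :=
    tendsto_iff_norm_sub_tendsto_zero.1 ((hS.continuous (F t)).comp hσ).continuousAt
  refine squeeze_zero (fun _ => norm_nonneg _) (fun s => ?_) (by simpa using h1.add h2)
  have : S (σ s) (F s) - S (σ t) (F t) =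
      S (σ s) (F s - F t) + (S (σ s) (F t) - S (σ t) (F t)) := by rw [map_sub]; abel
  rw [this]
  refine (norm_add_le _ _).trans ?_
  rw [hS.norm_apply]

/-- The vector `x` may lie outside the domain: the group is moved onto `φ` before differentiating.
-/
theorem IsFlow.hasDerivAt_inner {A : H → H → Prop} {S : ℝ → H →L[ℂ] H} (hS : IsFlow A S)
    {φ ψ : H} (h : A φ ψ) (x : H) (t : ℝ) :
    HasDerivAt (fun t => (inner ℂ φ (S t x) : ℂ)) (Complex.I * inner ℂ ψ (S t x)) t := by
  have h1 := (hS.hasDerivAt h (-t)).scomp t (hasDerivAt_neg t)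
  rw [neg_one_smul] at h1
  have h2 := h1.inner ℂ (hasDerivAt_const t x)
  have h3 : ∀ (t : ℝ) (y : H), inner ℂ (S (-t) y) x = inner ℂ y (S t x) := fun t y => by
    rw [hS.inner_apply, neg_neg]
  simp only [Function.comp_apply, h3, inner_neg_left, inner_smul_left, inner_zero_right,
    Complex.conj_I] at h2
  exact h2.congr_deriv (by ring)

/-- `u` is the weak solution on `[0, T]` of `i u' + A u = F`, `u 0 = u₀`. -/
structure IsWeakSolution (A : H → H → Prop) (T : ℝ) (F : ℝ → H) (u₀ : H) (u : ℝ → H) :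
    Prop where
  continuousOn : ContinuousOn u (Icc 0 T)
  initial : u 0 = u₀
  equation : ∀ φ ψ : H, A φ ψ → ∀ t ∈ Icc (0 : ℝ) T,
    inner ℂ φ (u t) = inner ℂ φ u₀ +
      ∫ s in (0 : ℝ)..t, (Complex.I * inner ℂ ψ (u s) - Complex.I * inner ℂ φ (F s))

/-- **Duhamel's formula**. -/
theorem IsFlow.isWeakSolution [CompleteSpace H] {A : H → H → Prop} {S : ℝ → H →L[ℂ] H}
    (hS : IsFlow A S) (T : ℝ)
    {F : ℝ → H} (hF : Continuous F) (u₀ : H) :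
    IsWeakSolution A T F u₀
      fun t => S t (u₀ - Complex.I • ∫ s in (0 : ℝ)..t, S (-s) (F s)) := by
  have hc : Continuous fun s => S (-s) (F s) := hS.continuous_apply continuous_neg hF
  -- Variation of constants: `G = S (-t) u` is differentiable even when `u` leaves the domain, and
  -- the unbounded part of the derivative falls on the test vector.
  set G : ℝ → H := fun t => u₀ - Complex.I • ∫ s in (0 : ℝ)..t, S (-s) (F s) with hG
  have hGd : ∀ t, HasDerivAt G (-(Complex.I • S (-t) (F t))) t := fun t =>
    ((intervalIntegral.integral_hasDerivAt_right (hc.intervalIntegrable _ _)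
      (hc.stronglyMeasurableAtFilter _ _) hc.continuousAt).const_smul _).const_sub _
  have hGc : Continuous G := continuous_iff_continuousAt.2 fun t => (hGd t).continuousAt
  have hu : Continuous fun t => S t (G t) := hS.continuous_apply continuous_id hGc
  refine ⟨hu.continuousOn, by simp [hS.zero], fun φ ψ h t _ => ?_⟩
  have hd : ∀ t, HasDerivAt (fun t => (inner ℂ φ (S t (G t)) : ℂ))
      (Complex.I * inner ℂ ψ (S t (G t)) - Complex.I * inner ℂ φ (F t)) t := by
    intro t
    have h1 : HasDerivAt (fun t => S (-t) φ) (-(Complex.I • S (-t) ψ)) t := by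
      have := (hS.hasDerivAt h (-t)).scomp t (hasDerivAt_neg t)
      rwa [neg_one_smul] at this
    have h2 := h1.inner ℂ (hGd t)
    have h3 : ∀ (t : ℝ) (x y : H), inner ℂ (S (-t) x) y = inner ℂ x (S t y) := fun t x y => by
      rw [hS.inner_apply, neg_neg]
    have h4 : ∀ x : H, S t (S (-t) x) = x := fun x => by
      simpa using hS.neg_apply (-t) x
    simp only [h3, map_neg, map_smul, inner_neg_left, inner_neg_right, inner_smul_left, inner_smul_right, h4,
      Complex.conj_I] at h2
    exact h2.congr_deriv (by ring)
  rw [intervalIntegral.integral_eq_sub_of_hasDerivAt (fun s _ => hd s)]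
  · simp [hS.zero, hG]
  · exact (((continuous_const.inner hu).const_mul _).sub
      ((continuous_const.inner hF).const_mul _)).intervalIntegrable _ _

/-- Uniqueness of the weak solution of the homogeneous equation. -/
theorem IsFlow.eq_of_isWeakSolution [CompleteSpace H] {A : H → H → Prop} {S : ℝ → H →L[ℂ] H}
    (hA : NonposSelfAdjoint A)
    (hS : IsFlow A S) {T : ℝ} {v₀ : H} {v : ℝ → H} (hv : IsWeakSolution A T (fun _ => 0) v₀ v)
    {t : ℝ} (ht : t ∈ Icc 0 T) : v t = S t v₀ := by
  have hw : IsWeakSolution A T (fun _ => 0) v₀ fun t => S t v₀ := by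
    simpa using hS.isWeakSolution T (F := fun _ => 0) continuous_const v₀
  set z : ℝ → H := fun t => v t - S t v₀ with hz
  have hzc : ContinuousOn z (Icc 0 T) := hv.continuousOn.sub hw.continuousOn
  -- Applying `R = (1 - A)⁻¹` to the difference `z` of two weak solutions turns it into a
  -- differentiable function, with `(R z)' = i A R z = i (R z - z)`.
  set R := hA.resolvent one_pos with hR
  have hzint : ∀ t ∈ Icc 0 T, ContinuousOn z (uIcc 0 t) := fun t ht =>
    hzc.mono (by rw [uIcc_of_le ht.1]; exact Icc_subset_Icc_right ht.2)
  have hzR : ∀ t ∈ Icc 0 T, R (z t) = ∫ s in (0 : ℝ)..t, Complex.I • (R (z s) - z s) := by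
    intro t ht
    refine ext_inner_left ℂ fun x => ?_
    have hx := hA.resolvent_mem one_pos x
    rw [Complex.ofReal_one, one_smul] at hx
    have h1 := hv.equation _ _ hx t ht
    have h2 := hw.equation _ _ hx t ht
    have hvc : ContinuousOn v (uIcc 0 t) :=
      hv.continuousOn.mono (by rw [uIcc_of_le ht.1]; exact Icc_subset_Icc_right ht.2)
    have hwc : ContinuousOn (fun t => S t v₀) (uIcc 0 t) := (hS.continuous v₀).continuousOn
    have hRz := R.continuous.comp_continuousOn (hzint t ht)
    have hc := (hRz.sub (hzint t ht)).const_smul Complex.I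
    have h3 := (innerSL ℂ x).intervalIntegral_comp_comm (hc.intervalIntegrable (μ := volume))
    simp only [innerSL_apply_apply] at h3
    rw [← hA.inner_resolvent, hz]
    simp only [inner_sub_right, h1, h2]
    rw [add_sub_add_left_eq_sub, ← intervalIntegral.integral_sub]
    · refine Eq.trans ?_ h3
      refine intervalIntegral.integral_congr fun s _ => ?_
      simp only [inner_sub_left, inner_sub_right, inner_zero_right, inner_smul_right,
        Function.comp_apply, Pi.smul_apply, Pi.sub_apply, ← hA.inner_resolvent, map_sub, hz, hR]
      ring
    · simp only [inner_zero_right, mul_zero, sub_zero]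
      exact ((continuousOn_const.inner hvc).const_mul _).intervalIntegrable
    · simp only [inner_zero_right, mul_zero, sub_zero]
      exact ((continuousOn_const.inner hwc).const_mul _).intervalIntegrable
  have hT : 0 ≤ T := ht.1.trans ht.2
  -- A continuous extension to the whole line lets the primitive `Y` be differentiated at the
  -- endpoints as well.
  set zE : ℝ → H := IccExtend hT ((Icc 0 T).domRestrict z) with hzE
  have hzEc : Continuous zE := continuous_IccExtend_iff.2 hzc.domRestrict
  have hzEeq : ∀ s ∈ Icc 0 T, zE s = z s := fun s hs => by
    rw [hzE, IccExtend_of_mem hT _ hs]; rfl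
  set Y : ℝ → H := fun t => ∫ s in (0 : ℝ)..t, Complex.I • (R (zE s) - zE s) with hY
  have hYc : Continuous fun s => Complex.I • (R (zE s) - zE s) :=
    ((R.continuous.comp hzEc).sub hzEc).const_smul _
  have hYd : ∀ t, HasDerivAt Y (Complex.I • (R (zE t) - zE t)) t := fun t =>
    intervalIntegral.integral_hasDerivAt_right (hYc.intervalIntegrable _ _)
      (hYc.stronglyMeasurableAtFilter _ _) hYc.continuousAt
  have hYR : ∀ t ∈ Icc 0 T, Y t = R (zE t) := fun t ht => by
    rw [hzEeq t ht, hzR t ht]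
    refine intervalIntegral.integral_congr fun s hs => ?_
    rw [uIcc_of_le ht.1] at hs
    simp only [hzEeq s ⟨hs.1, hs.2.trans ht.2⟩]
  -- Energy conservation: the derivative of `‖R z‖²` is `i (⟨z, R z⟩ - ⟨R z, z⟩)`, which vanishes by
  -- symmetry of `R`.
  have hN := constant_of_has_deriv_right_zero (f := fun t => (inner ℂ (Y t) (Y t) : ℂ))
    (a := 0) (b := T)
    (continuous_iff_continuousAt.2 fun t => ((hYd t).inner ℂ (hYd t)).continuousAt).continuousOn
    (fun t ht => by
      have h1 := (hYd t).inner ℂ (hYd t)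
      have h2 := hA.inner_resolvent one_pos (zE t) (zE t)
      rw [hYR t (Ico_subset_Icc_self ht)] at h1
      simp only [inner_smul_right, inner_smul_left, inner_sub_left, inner_sub_right,
        Complex.conj_I, ← hR] at h1 h2
      rw [← h2] at h1
      convert h1.hasDerivWithinAt using 1
      ring) t ht
  simp only [hY, intervalIntegral.integral_same, inner_zero_left, inner_self_eq_zero] at hN
  have hRz : R (z t) = 0 := by rw [← hzEeq t ht, ← hYR t ht]; exact hN
  -- If `R z = 0`, the graph of `A` contains `(0, -z)`, so by symmetry `z` is orthogonal to the
  -- domain.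
  have hz0 : z t = 0 := by
    refine hA.dense _ fun u f h => ?_
    have h1 := hA.resolvent_mem one_pos (z t)
    rw [← hR, hRz, smul_zero, zero_sub] at h1
    have h2 := hA.symm h h1
    rw [inner_zero_right, inner_neg_right] at h2
    exact neg_eq_zero.1 h2.symm
  exact sub_eq_zero.1 hz0

end AbstractEvolution

/-! ### Observability, controllability and the resolvent estimate in Hilbert space -/

section AbstractControl

variable {H : Type*} [NormedAddCommGroup H] [InnerProductSpace ℂ H]
  {A : H → H → Prop} {S : ℝ → H →L[ℂ] H} {P : H →L[ℂ] H}

theorem integral_sin_sq_pi_mul_div {T : ℝ} (hT : 0 < T) :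
    ∫ t in (0 : ℝ)..T, Real.sin (Real.pi / T * t) ^ 2 = T / 2 := by
  rw [intervalIntegral.integral_comp_mul_left (fun x => Real.sin x ^ 2) (by positivity),
    integral_sin_sq, mul_zero, div_mul_cancel₀ _ hT.ne']
  simp
  field_simp

theorem integral_cos_sq_pi_mul_div {T : ℝ} (hT : 0 < T) :
    ∫ t in (0 : ℝ)..T, Real.cos (Real.pi / T * t) ^ 2 = T / 2 := by
  rw [intervalIntegral.integral_comp_mul_left (fun x => Real.cos x ^ 2) (by positivity),
    integral_cos_sq, mul_zero, div_mul_cancel₀ _ hT.ne']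
  simp
  field_simp

/-- Observability implies the resolvent estimate. -/
theorem IsFlow.resolventEstimate_of_observable (hS : IsFlow A S)
    (hP : ∀ x, ‖P x‖ ≤ ‖x‖) {T C : ℝ} (hT : 0 < T)
    (hobs : ∀ x, ‖x‖ ^ 2 ≤ C * ∫ t in (0 : ℝ)..T, ‖P (S t x)‖ ^ 2) (l : ℝ) {u f : H}
    (h : A u f) :
    ‖u‖ ^ 2 ≤ 2 * C * T ^ 3 / 3 * ‖f - (l : ℂ) • u‖ ^ 2 + 2 * C * T * ‖P u‖ ^ 2 := by
  -- A negative constant forces the space to be trivial; `C ≥ 0` is needed below to multiply the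
  -- integral bound.
  rcases lt_or_ge C 0 with hC | hC
  · have hzero : ∀ x : H, x = 0 := fun x => by
      have hJ : 0 ≤ ∫ t in (0 : ℝ)..T, ‖P (S t x)‖ ^ 2 :=
        intervalIntegral.integral_nonneg hT.le fun t _ => by positivity
      have h2 : ‖x‖ ^ 2 ≤ 0 := (hobs x).trans (mul_nonpos_of_nonpos_of_nonneg hC.le hJ)
      exact norm_eq_zero.1 (pow_eq_zero_iff two_ne_zero |>.1 (le_antisymm h2 (by positivity)))
    rw [hzero u, hzero f]
    simp
  set r := f - (l : ℂ) • u with hr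
  -- The phase cancels `l`: what remains is a derivative of constant norm `‖r‖`, so the orbit moves
  -- at most `‖r‖ t` away from `u`.
  have hk : ∀ t : ℝ, HasDerivAt (fun t : ℝ => Complex.exp (-(l * t * Complex.I)) • S t u)
      (Complex.exp (-(l * t * Complex.I)) • (Complex.I • S t r)) t := fun t => by
    have h1 : HasDerivAt (fun t : ℝ => -((l : ℂ) * t * Complex.I)) (-(l * 1 * Complex.I)) t :=
      (((hasDerivAt_id t).ofReal_comp.const_mul (l : ℂ)).mul_const Complex.I).neg
    refine (h1.cexp.smul (hS.hasDerivAt h t)).congr_deriv ?_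
    rw [hr, map_sub, map_smul]
    module
  have hexp : ∀ t : ℝ, ‖Complex.exp (-(l * t * Complex.I))‖ = 1 := fun t => by
    rw [← neg_mul, ← Complex.ofReal_mul, ← Complex.ofReal_neg, Complex.norm_exp_ofReal_mul_I]
  -- The factors `2` come from `(a + b)² ≤ 2a² + 2b²`; integrating `t²` produces `T ^ 3 / 3`.
  have hPS : ∀ t ∈ Icc 0 T, ‖P (S t u)‖ ^ 2 ≤ 2 * ‖P u‖ ^ 2 + 2 * ‖r‖ ^ 2 * t ^ 2 := by
    intro t ht
    have h1 := Convex.norm_image_sub_le_of_norm_hasDerivWithin_le (𝕜 := ℝ) (s := univ) (x := 0)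
      (y := t) (fun r _ => (hk r).hasDerivWithinAt) (C := ‖r‖)
      (fun s _ => by
        rw [norm_smul, norm_smul, hexp, Complex.norm_I, one_mul, one_mul, hS.norm_apply])
      convex_univ (mem_univ _) (mem_univ _)
    simp only [hS.zero, sub_zero, Real.norm_eq_abs, abs_of_nonneg ht.1, Complex.ofReal_zero,
      mul_zero, zero_mul, neg_zero, Complex.exp_zero, one_smul, one_apply_eq_self] at h1
    have h2 : ‖P (S t u)‖ ≤ ‖P u‖ + ‖r‖ * t := by
      calc ‖P (S t u)‖ = ‖P (Complex.exp (-(l * t * Complex.I)) • S t u)‖ := by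
            rw [map_smul, norm_smul, hexp, one_mul]
        _ = ‖P u + P (Complex.exp (-(l * t * Complex.I)) • S t u - u)‖ := by
            rw [map_sub, add_sub_cancel]
        _ ≤ ‖P u‖ + ‖r‖ * t := (norm_add_le _ _).trans (by gcongr; exact (hP _).trans h1)
    calc ‖P (S t u)‖ ^ 2 ≤ (‖P u‖ + ‖r‖ * t) ^ 2 := by gcongr
      _ ≤ _ := by nlinarith [sq_nonneg (‖P u‖ - ‖r‖ * t)]
  have hSc := hS.continuous u
  have hint : ∫ t in (0 : ℝ)..T, ‖P (S t u)‖ ^ 2 ≤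
      ∫ t in (0 : ℝ)..T, (2 * ‖P u‖ ^ 2 + 2 * ‖r‖ ^ 2 * t ^ 2) :=
    intervalIntegral.integral_mono_on hT.le (Continuous.intervalIntegrable (by fun_prop) _ _)
      (Continuous.intervalIntegrable (by fun_prop) _ _) hPS
  rw [intervalIntegral.integral_add (Continuous.intervalIntegrable (by fun_prop) _ _)
    (Continuous.intervalIntegrable (by fun_prop) _ _), intervalIntegral.integral_const,
    intervalIntegral.integral_const_mul, integral_pow] at hint
  refine (hobs u).trans ((mul_le_mul_of_nonneg_left hint hC).trans_eq ?_)
  simp only [smul_eq_mul]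
  push_cast
  ring

variable [CompleteSpace H]

/-- The Fourier coefficients of `sin (π t / T) • exp (i t A) x` on `[0, T]` belong to the domain
of `A`. -/
theorem IsFlow.fourierCoeffOn_mem (hA : NonposSelfAdjoint A) (hS : IsFlow A S) {T : ℝ}
    (hT : 0 < T) (x : H) (k : ℤ) :
    A (fourierCoeffOn hT (fun t => (Real.sin (Real.pi / T * t) : ℂ) • S t x) k)
      (((2 * Real.pi * k / T : ℝ) : ℂ) •
          fourierCoeffOn hT (fun t => (Real.sin (Real.pi / T * t) : ℂ) • S t x) k +
        fourierCoeffOn hT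
          (fun t => ((Real.pi / T * Real.cos (Real.pi / T * t) : ℝ) : ℂ) •
            (Complex.I • S t x)) k) := by
  have hSc := hS.continuous x
  have hc1 : Continuous fun t => (Real.sin (Real.pi / T * t) : ℂ) • S t x := by fun_prop
  have hc2 : Continuous fun t => ((Real.pi / T * Real.cos (Real.pi / T * t) : ℝ) : ℂ) •
      (Complex.I • S t x) := by fun_prop
  -- The orbit need not meet the domain of `A`, so membership of the coefficient is tested weakly
  -- against `φ` in the domain.
  refine hA.mem_of_adjoint fun φ ψ h => ?_
  rw [inner_add_right, inner_smul_right, inner_fourierCoeffOn hT hc1.continuousOn,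
    inner_fourierCoeffOn hT hc1.continuousOn, inner_fourierCoeffOn hT hc2.continuousOn]
  simp only [fourierCoeffOn_eq_integral, inner_smul_right, Complex.real_smul, smul_eq_mul]
  have hec : Continuous fun t : ℝ => fourier (-k) (t : AddCircle (T - 0)) :=
    (fourier (T := T - 0) (-k)).continuous.comp (AddCircle.continuous_mk' _)
  have hed := hasDerivAt_fourier_neg (T - 0) k
  have hT' : ((T - 0 : ℝ) : ℂ) = T := by rw [sub_zero]
  rw [hT'] at hed
  obtain ⟨e, he⟩ : ∃ e : ℝ → ℂ, ∀ t : ℝ, fourier (-k) (t : AddCircle (T - 0)) = e t :=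
    ⟨_, fun _ => rfl⟩
  simp only [he] at hec hed ⊢
  have hsd : ∀ t : ℝ, HasDerivAt (fun t : ℝ => (Real.sin (Real.pi / T * t) : ℂ))
      ((Real.pi / T * Real.cos (Real.pi / T * t) : ℝ) : ℂ) t := fun t => by
    have h1 : HasDerivAt (fun t : ℝ => Real.pi / T * t) (Real.pi / T) t := by
      simpa using (hasDerivAt_id t).const_mul (Real.pi / T)
    exact (h1.sin.congr_deriv (by ring)).ofReal_comp
  -- Integration by parts; the sine kills both boundary terms, although `S t x` is not periodic.
  have hint := intervalIntegral.integral_eq_sub_of_hasDerivAt (a := 0) (b := T)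
    (fun t _ => ((hed t).mul (hsd t)).mul (hS.hasDerivAt_inner h x t))
    (Continuous.intervalIntegrable (by fun_prop) _ _)
  simp only [Pi.mul_apply, mul_zero, Real.sin_zero, div_mul_cancel₀ _ hT.ne', Real.sin_pi,
    Complex.ofReal_zero, zero_mul, sub_self] at hint
  have hi1 : IntervalIntegrable (fun t => e t * ((Real.sin (Real.pi / T * t) : ℂ) *
      inner ℂ ψ (S t x))) volume 0 T := Continuous.intervalIntegrable (by fun_prop) _ _
  have hi2 : IntervalIntegrable (fun t => e t * ((Real.sin (Real.pi / T * t) : ℂ) *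
      inner ℂ φ (S t x))) volume 0 T := Continuous.intervalIntegrable (by fun_prop) _ _
  have hi3 : IntervalIntegrable (fun t => e t *
      (((Real.pi / T * Real.cos (Real.pi / T * t) : ℝ) : ℂ) * (Complex.I * inner ℂ φ (S t x))))
      volume 0 T := Continuous.intervalIntegrable (by fun_prop) _ _
  rw [← mul_assoc, mul_comm (((2 * Real.pi * k / T : ℝ) : ℂ)), mul_assoc, ← mul_add]
  congr 1
  rw [← intervalIntegral.integral_const_mul, ← intervalIntegral.integral_add (hi2.const_mul _) hi3,
    ← sub_eq_zero, ← intervalIntegral.integral_sub hi1 ((hi2.const_mul _).add hi3)]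
  rw [← mul_eq_zero_iff_left Complex.I_ne_zero,
    ← intervalIntegral.integral_const_mul, ← hint]
  refine intervalIntegral.integral_congr fun t _ => ?_
  have hTc : (T : ℂ) ≠ 0 := by exact_mod_cast hT.ne'
  push_cast
  have hI := Complex.I_sq
  field_simp
  ring_nf
  rw [hI]
  ring

/-- The resolvent estimate implies observability. -/
theorem IsFlow.observable_of_resolventEstimate [SeparableSpace H] (hA : NonposSelfAdjoint A)
    (hS : IsFlow A S) {M m : ℝ} (hM : 0 < M) (hm : 0 < m)
    (hres : ∀ (l : ℝ) (u f : H), A u f →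
      ‖u‖ ^ 2 ≤ M * ‖f - (l : ℂ) • u‖ ^ 2 + m * ‖P u‖ ^ 2) {T : ℝ}
    (hT : Real.pi * Real.sqrt M < T) (x : H) :
    ‖x‖ ^ 2 ≤ 2 * m * T / (T ^ 2 - M * Real.pi ^ 2) * ∫ t in (0 : ℝ)..T, ‖P (S t x)‖ ^ 2 := by
  have hT0 : 0 < T := lt_of_le_of_lt (by positivity) hT
  have hTM : 0 < T ^ 2 - M * Real.pi ^ 2 := by
    have h1 : (Real.pi * Real.sqrt M) ^ 2 < T ^ 2 := by gcongr
    rw [mul_pow, Real.sq_sqrt hM.le] at h1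
    linarith
  have hSc := hS.continuous x
  have hc1 : Continuous fun t => (Real.sin (Real.pi / T * t) : ℂ) • S t x := by fun_prop
  have hc2 : Continuous fun t => ((Real.pi / T * Real.cos (Real.pi / T * t) : ℝ) : ℂ) •
      (Complex.I • S t x) := by fun_prop
  have hc3 : Continuous fun t => P ((Real.sin (Real.pi / T * t) : ℂ) • S t x) :=
    P.continuous.comp hc1
  have hc4 : Continuous fun t => ‖P (S t x)‖ ^ 2 := by fun_prop
  -- The resolvent estimate at `λ = 2πk/T`, summed over all `k`.
  have key := hasSum_le (fun k => ?_) (hasSum_norm_sq_fourierCoeffOn hT0 hc1.continuousOn)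
    (((hasSum_norm_sq_fourierCoeffOn hT0 hc2.continuousOn).mul_left M).add
      ((hasSum_norm_sq_fourierCoeffOn hT0 hc3.continuousOn).mul_left m))
  · have h1 : ∫ t in (0 : ℝ)..T, ‖(Real.sin (Real.pi / T * t) : ℂ) • S t x‖ ^ 2 =
        T / 2 * ‖x‖ ^ 2 := by
      simp only [norm_smul, hS.norm_apply, Complex.norm_real, mul_pow, Real.norm_eq_abs, sq_abs]
      rw [intervalIntegral.integral_mul_const, integral_sin_sq_pi_mul_div hT0]
    have h2 : ∫ t in (0 : ℝ)..T, ‖((Real.pi / T * Real.cos (Real.pi / T * t) : ℝ) : ℂ) •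
        (Complex.I • S t x)‖ ^ 2 = (Real.pi / T) ^ 2 * (T / 2) * ‖x‖ ^ 2 := by
      simp only [norm_smul, hS.norm_apply, Complex.norm_real, mul_pow, Real.norm_eq_abs, sq_abs,
        Complex.norm_I, one_mul]
      rw [intervalIntegral.integral_mul_const, intervalIntegral.integral_const_mul,
        integral_cos_sq_pi_mul_div hT0]
    have h3 : ∫ t in (0 : ℝ)..T, ‖P ((Real.sin (Real.pi / T * t) : ℂ) • S t x)‖ ^ 2 ≤
        ∫ t in (0 : ℝ)..T, ‖P (S t x)‖ ^ 2 := by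
      refine intervalIntegral.integral_mono_on hT0.le ((hc3.norm.pow 2).intervalIntegrable _ _)
        (hc4.intervalIntegrable _ _) fun t _ => ?_
      rw [map_smul, norm_smul, mul_pow, Complex.norm_real, Real.norm_eq_abs, sq_abs]
      exact mul_le_of_le_one_left (by positivity) (Real.sin_sq_le_one _)
    have key := mul_le_mul_of_nonneg_left key hT0.le
    rw [h1, h2, sub_zero, mul_add, mul_left_comm T M, mul_left_comm T m,
      mul_inv_cancel_left₀ hT0.ne', mul_inv_cancel_left₀ hT0.ne', mul_inv_cancel_left₀ hT0.ne'] at key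
    have h4 := mul_le_mul_of_nonneg_left h3 hm.le
    rw [div_mul_eq_mul_div, le_div_iff₀ hTM]
    -- Multiplying `key` by `2 T` turns it into `(T² - M π²) ‖x‖² ≤ 2 m T ∫ ‖P S t x‖²`.
    have h5 : M * ((Real.pi / T) ^ 2 * (T / 2) * ‖x‖ ^ 2) * (2 * T) =
        M * Real.pi ^ 2 * ‖x‖ ^ 2 := by
      field_simp
    nlinarith
  · have h1 := hres (2 * Real.pi * k / T) _ _ (hS.fourierCoeffOn_mem hA hT0 x k)
    rwa [add_sub_cancel_left, P.map_fourierCoeffOn hT0 hc1.continuousOn] at h1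

/-- Observability implies exact controllability, with continuous controls. -/
theorem IsFlow.exists_control (hS : IsFlow A S)
    (hP : ∀ x y, inner ℂ (P x) y = inner ℂ x (P y)) {T C : ℝ} (hT : 0 < T)
    (hobs : ∀ x, ‖x‖ ^ 2 ≤ C * ∫ t in (0 : ℝ)..T, ‖P (S t x)‖ ^ 2) (u₀ u₁ : H) :
    ∃ h : ℝ → H, Continuous h ∧ ∃ u, IsWeakSolution A T (fun t => P (h t)) u₀ u ∧ u T = u₁ := by
  have hcont : ∀ x, Continuous fun t => S (-t) (P (P (S t x))) := fun x =>
    hS.continuous_apply continuous_neg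
      (P.continuous.comp (P.continuous.comp (hS.continuous x)))
  -- The controllability Gramian; its quadratic form is the observed energy, so observability makes
  -- it coercive.
  let G : H →L[ℂ] H := LinearMap.mkContinuous
    { toFun := fun x => ∫ t in (0 : ℝ)..T, S (-t) (P (P (S t x)))
      map_add' := fun x y => by
        rw [← intervalIntegral.integral_add ((hcont x).intervalIntegrable _ _)
          ((hcont y).intervalIntegrable _ _)]
        simp only [map_add]
      map_smul' := fun c x => by
        simp only [map_smul, intervalIntegral.integral_smul, RingHom.id_apply] } (‖P‖ * ‖P‖ * T)
    (fun x => by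
      have := intervalIntegral.norm_integral_le_of_norm_le_const (a := 0) (b := T)
        (f := fun t => S (-t) (P (P (S t x)))) (C := ‖P‖ * ‖P‖ * ‖x‖) (fun t _ => by
          rw [hS.norm_apply, ← hS.norm_apply t x, mul_assoc]
          exact (P.le_opNorm _).trans (by gcongr; exact P.le_opNorm _))
      rw [sub_zero, abs_of_pos hT] at this
      refine this.trans_eq (by ring))
  have hG : ∀ x, G x = ∫ t in (0 : ℝ)..T, S (-t) (P (P (S t x))) := fun x => rfl
  have hGi : ∀ x, inner ℂ (G x) x = ((∫ t in (0 : ℝ)..T, ‖P (S t x)‖ ^ 2 : ℝ) : ℂ) := fun x => by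
    rw [← inner_conj_symm, hG]
    have h1 := (innerSL ℂ x).intervalIntegral_comp_comm
      ((hcont x).intervalIntegrable (μ := volume) 0 T)
    simp only [innerSL_apply_apply] at h1
    rw [← h1, ← Complex.conj_ofReal, ← intervalIntegral.integral_ofReal]
    congr 1
    refine intervalIntegral.integral_congr fun t _ => ?_
    rw [← hS.inner_apply, ← hP, inner_self_eq_norm_sq_to_K]
    norm_cast
  have hunit : IsUnit G := by
    -- The maximum with `1` keeps the coercivity constant positive whatever the sign of `C`.
    refine ContinuousLinearMap.isUnit_of_forall_le_norm_inner_map G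
      (c := (max C 1)⁻¹.toNNReal) (by simp) fun x => ?_
    have hJ : 0 ≤ ∫ t in (0 : ℝ)..T, ‖P (S t x)‖ ^ 2 :=
      intervalIntegral.integral_nonneg hT.le fun t _ => by positivity
    have hC : 0 < max C 1 := lt_max_of_lt_right one_pos
    rw [hGi, Complex.norm_real, Real.norm_of_nonneg hJ, Real.coe_toNNReal _ (by positivity),
      ← div_eq_mul_inv, div_le_iff₀ hC, mul_comm]
    exact (hobs x).trans (by gcongr; exact le_max_left _ _)
  -- This right-hand side is what makes Duhamel's formula at time `T` return `u₁` when the control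
  -- is `P S t x`.
  obtain ⟨x, hx⟩ : ∃ x, G x = Complex.I • (S (-T) u₁ - u₀) := by
    obtain ⟨V, hV⟩ := hunit
    refine ⟨(↑V⁻¹ : H →L[ℂ] H) (Complex.I • (S (-T) u₁ - u₀)), ?_⟩
    have : G * (↑V⁻¹ : H →L[ℂ] H) = 1 := by rw [← hV]; exact V.mul_inv
    exact congrArg (fun B : H →L[ℂ] H => B (Complex.I • (S (-T) u₁ - u₀))) this
  refine ⟨fun t => P (S t x), P.continuous.comp (hS.continuous x), _,
    hS.isWeakSolution T (P.continuous.comp (P.continuous.comp (hS.continuous x))) u₀, ?_⟩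
  have h1 : ∫ t in (0 : ℝ)..T, S (-t) (P (P (S t x))) = Complex.I • (S (-T) u₁ - u₀) := by
    rw [← hG, hx]
  have h2 := hS.neg_apply (-T) u₁
  rw [neg_neg] at h2
  simp only [Function.comp_apply, h1, smul_smul, Complex.I_mul_I, neg_smul, one_smul,
    sub_neg_eq_add, add_sub_cancel, h2]

/-- Bound, uniform in `l`, for the integrated form of `a' = i l a + r`, `a 0 = 0`. -/
theorem norm_le_integral_of_integral_equation {T l : ℝ} (hT : 0 ≤ T) {a r : ℝ → ℂ}
    (ha : ContinuousOn a (Icc 0 T)) (hr : IntervalIntegrable r volume 0 T)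
    (h : ∀ t ∈ Icc 0 T, a t = ∫ s in (0 : ℝ)..t, (Complex.I * l * a s + r s)) :
    ‖a T‖ ≤ ∫ s in (0 : ℝ)..T, ‖r s‖ := by
  -- The integrating factor, of modulus one; the aim is `a T = ∫ E r`.
  set E : ℝ → ℂ := fun t => Complex.exp (((l * (T - t) : ℝ) : ℂ) * Complex.I) with hE
  have hEn : ∀ t, ‖E t‖ = 1 := fun t => Complex.norm_exp_ofReal_mul_I _
  have hEd : ∀ t, HasDerivAt E (-(Complex.I * l * E t)) t := fun t => by
    have h1 : HasDerivAt (fun t : ℝ => l * (T - t)) (-l) t := by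
      simpa using ((hasDerivAt_id t).const_sub T).const_mul l
    refine ((h1.ofReal_comp.mul_const Complex.I).cexp).congr_deriv ?_
    simp only [hE]
    push_cast
    ring
  have hEc : Continuous E := continuous_iff_continuousAt.2 fun t => (hEd t).continuousAt
  have hET : E T = 1 := by simp [hE]
  have hrsub : ∀ t ∈ Icc 0 T, IntervalIntegrable r volume 0 t := fun t ht =>
    hr.mono_set (by rw [uIcc_of_le ht.1, uIcc_of_le hT]; exact Icc_subset_Icc_right ht.2)
  set aE : ℝ → ℂ := IccExtend hT ((Icc 0 T).domRestrict a) with haE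
  have haEc : Continuous aE := continuous_IccExtend_iff.2 ha.domRestrict
  have haEeq : ∀ s ∈ Icc 0 T, aE s = a s := fun s hs => by
    rw [haE, IccExtend_of_mem hT _ hs]; rfl
  -- As `r` is only integrable, `a` is not differentiated. Its primitive `b` is continuously
  -- differentiable and solves `b' = i l b + K` on `[0, T]`.
  set b : ℝ → ℂ := fun t => ∫ s in (0 : ℝ)..t, aE s with hb
  set K : ℝ → ℂ := fun t => ∫ s in (0 : ℝ)..t, r s with hK
  have hbd : ∀ t, HasDerivAt b (aE t) t := fun t =>
    intervalIntegral.integral_hasDerivAt_right (haEc.intervalIntegrable _ _)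
      (haEc.stronglyMeasurableAtFilter _ _) haEc.continuousAt
  have hbc : Continuous b := continuous_iff_continuousAt.2 fun t => (hbd t).continuousAt
  have hab : ∀ t ∈ Icc 0 T, aE t = Complex.I * l * b t + K t := fun t ht => by
    rw [haEeq t ht, h t ht, hb, hK]
    simp only
    rw [← intervalIntegral.integral_const_mul, ← intervalIntegral.integral_add
      ((haEc.intervalIntegrable _ _).const_mul _) (hrsub t ht)]
    refine intervalIntegral.integral_congr fun s hs => ?_
    rw [uIcc_of_le ht.1] at hs
    simp only [haEeq s ⟨hs.1, hs.2.trans ht.2⟩]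
  have hbT : b T = ∫ t in (0 : ℝ)..T, E t * K t := by
    have h1 := intervalIntegral.integral_eq_sub_of_hasDerivAt (a := 0) (b := T)
      (fun t _ => (hEd t).mul (hbd t)) (Continuous.intervalIntegrable (by fun_prop) _ _)
    have h2 : b 0 = 0 := intervalIntegral.integral_same
    simp only [Pi.mul_apply, hET, h2, one_mul, mul_zero, sub_zero] at h1
    rw [← h1]
    refine intervalIntegral.integral_congr fun t ht => ?_
    rw [uIcc_of_le hT] at ht
    simp only [hab t ht]
    ring
  -- Fubini on the triangle `s ≤ t`, with `∫ i l E` over `[s, T]` equal to `E s - E T = E s - 1`.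
  have hfub : ∫ t in (0 : ℝ)..T, Complex.I * l * E t * K t =
      ∫ s in (0 : ℝ)..T, (E s - 1) * r s := by
    rw [intervalIntegral.integral_of_le hT, intervalIntegral.integral_of_le hT]
    set μ := volume.restrict (Ioc 0 T) with hμ
    have hm : MeasurableSet {p : ℝ × ℝ | p.2 ≤ p.1} := measurableSet_le measurable_snd measurable_fst
    have hri : Integrable r μ := hr.1
    have hEi : Integrable (fun t => Complex.I * l * E t) μ :=
      ((by fun_prop : Continuous fun t => Complex.I * l * E t).integrableOn_Icc).mono_set
        Ioc_subset_Icc_self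
    have hint := (hEi.mul_prod hri).indicator hm
    have hswap := integral_integral_swap (f := fun t s =>
      {p : ℝ × ℝ | p.2 ≤ p.1}.indicator (fun p => Complex.I * l * E p.1 * r p.2) (t, s)) hint
    have hL : ∀ t ∈ Ioc 0 T, ∫ s, {p : ℝ × ℝ | p.2 ≤ p.1}.indicator
        (fun p => Complex.I * l * E p.1 * r p.2) (t, s) ∂μ = Complex.I * l * E t * K t := by
      intro t ht
      have : ∀ s, {p : ℝ × ℝ | p.2 ≤ p.1}.indicator
          (fun p => Complex.I * l * E p.1 * r p.2) (t, s) =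
          (Iic t).indicator (fun s => Complex.I * l * E t * r s) s := fun s => rfl
      simp only [this]
      rw [hμ, setIntegral_indicator measurableSet_Iic, Ioc_inter_Iic, min_eq_right ht.2, hK,
        ← intervalIntegral.integral_of_le ht.1.le, intervalIntegral.integral_const_mul]
    have hR : ∀ s ∈ Ioc 0 T, ∫ t, {p : ℝ × ℝ | p.2 ≤ p.1}.indicator
        (fun p => Complex.I * l * E p.1 * r p.2) (t, s) ∂μ = (E s - 1) * r s := by
      intro s hs
      have : ∀ t, {p : ℝ × ℝ | p.2 ≤ p.1}.indicator
          (fun p => Complex.I * l * E p.1 * r p.2) (t, s) =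
          (Ici s).indicator (fun t => Complex.I * l * E t * r s) t := fun t => rfl
      simp only [this]
      have hI : Ioc 0 T ∩ Ici s = Icc s T := by
        ext t
        simp only [mem_inter_iff, mem_Ioc, mem_Ici, mem_Icc]
        exact ⟨fun h => ⟨h.2, h.1.2⟩, fun h => ⟨⟨hs.1.trans_le h.1, h.2⟩, h.1⟩⟩
      rw [hμ, setIntegral_indicator measurableSet_Ici, hI, integral_Icc_eq_integral_Ioc,
        ← intervalIntegral.integral_of_le hs.2, intervalIntegral.integral_mul_const]
      congr 1
      have h1 := intervalIntegral.integral_eq_sub_of_hasDerivAt (a := s) (b := T)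
        (fun t _ => (hEd t).neg) (Continuous.intervalIntegrable (by fun_prop) _ _)
      simp only [neg_neg, Pi.neg_apply, hET] at h1
      rw [h1]
      ring
    rw [setIntegral_congr_fun measurableSet_Ioc hL, setIntegral_congr_fun measurableSet_Ioc hR]
      at hswap
    exact hswap
  have hfin : a T = ∫ s in (0 : ℝ)..T, E s * r s := by
    have hTm : T ∈ Icc 0 T := right_mem_Icc.2 hT
    have hEr : IntervalIntegrable (fun s => (E s - 1) * r s) volume 0 T :=
      hr.continuousOn_mul (by fun_prop)
    rw [← haEeq T hTm, hab T hTm, hbT, ← intervalIntegral.integral_const_mul]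
    simp only [← mul_assoc]
    rw [hfub, hK]
    simp only
    rw [← intervalIntegral.integral_add hEr hr]
    refine intervalIntegral.integral_congr fun s _ => ?_
    ring
  rw [hfin]
  refine (intervalIntegral.norm_integral_le_integral_norm hT).trans_eq ?_
  simp only [norm_mul, hEn, one_mul]

/-- Exact controllability with integrable controls implies the resolvent estimate. -/
theorem exists_resolventEstimate_of_controllable (hA : NonposSelfAdjoint A)
    (hP : ∀ x y, inner ℂ (P x) y = inner ℂ x (P y)) {T : ℝ} (hT : 0 < T)
    (hctrl : ∀ u₁, ∃ h : ℝ → H, IntervalIntegrable h volume 0 T ∧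
      ∃ y, IsWeakSolution A T (fun t => P (h t)) 0 y ∧ y T = u₁) :
    ∃ C : ℝ, 0 < C ∧ ∀ (l : ℝ) (u f : H), A u f →
      ‖u‖ ^ 2 ≤ C * ‖f - (l : ℂ) • u‖ ^ 2 + C * ‖P u‖ ^ 2 := by
  -- The spectral parameter is part of the index, so the uniform bound does not depend on it.
  let ι := {p : ℝ × H × H // A p.2.1 p.2.2 ∧ ‖p.2.2 - (p.1 : ℂ) • p.2.1‖ ≤ 1 ∧ ‖P p.2.1‖ ≤ 1}
  obtain ⟨C, hC⟩ := banach_steinhaus (g := fun i : ι => innerSL ℂ i.1.2.1) (by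
    intro u₁
    obtain ⟨h, hh, y, hy, rfl⟩ := hctrl u₁
    have hyc : ContinuousOn y (uIcc 0 T) := by rw [uIcc_of_le hT.le]; exact hy.continuousOn
    refine ⟨∫ s in (0 : ℝ)..T, (‖y s‖ + ‖h s‖), fun ⟨⟨l, u, f⟩, huf, hf1, hu1⟩ => ?_⟩
    simp only [innerSL_apply_apply] at huf hf1 hu1 ⊢
    set r : ℝ → ℂ := fun s => Complex.I * inner ℂ (f - (l : ℂ) • u) (y s) -
      Complex.I * inner ℂ (P u) (h s) with hrdef
    have hr : IntervalIntegrable r volume 0 T := by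
      refine (ContinuousOn.intervalIntegrable ?_).sub ?_
      · exact (continuousOn_const.inner hyc).const_mul _
      · refine IntervalIntegrable.const_mul ?_ _
        exact ⟨(innerSL ℂ (P u)).integrable_comp hh.1, (innerSL ℂ (P u)).integrable_comp hh.2⟩
    -- Writing `A u = l u + (f - l u)` gives `⟨u, y⟩` the equation `a' = i l a + r`, with `|r| ≤ ‖y‖
    -- + ‖h‖` for every index.
    have h1 := norm_le_integral_of_integral_equation (l := l) hT.le
      (a := fun t => inner ℂ u (y t)) (continuousOn_const.inner hy.continuousOn) hr
      (fun t ht => by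
        rw [hy.equation u f huf t ht, inner_zero_right, zero_add]
        refine intervalIntegral.integral_congr fun s _ => ?_
        simp only [hrdef, hP, inner_sub_left, inner_smul_left, Complex.conj_ofReal]
        ring)
    refine h1.trans (intervalIntegral.integral_mono_on hT.le hr.norm
      (hyc.norm.intervalIntegrable.add hh.norm) fun s _ => ?_)
    refine (norm_sub_le _ _).trans (add_le_add ?_ ?_)
    · rw [norm_mul, Complex.norm_I, one_mul]
      exact (norm_inner_le_norm _ _).trans (mul_le_of_le_one_left (norm_nonneg _) hf1)
    · rw [norm_mul, Complex.norm_I, one_mul]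
      exact (norm_inner_le_norm _ _).trans (mul_le_of_le_one_left (norm_nonneg _) hu1))
  have hbound : ∀ (l : ℝ) (u f : H), A u f →
      ‖u‖ ≤ max C 1 * (‖f - (l : ℂ) • u‖ + ‖P u‖) := by
    intro l u f huf
    refine le_of_forall_pos_le_add fun ε hε => ?_
    have hC0 : 0 < max C 1 := lt_max_of_lt_right one_pos
    -- Rescaling by `R⁻¹` lands in the index set. The `ε` term keeps `R` positive when both norms
    -- vanish, and it costs exactly `ε` in the end.
    set R := ‖f - (l : ℂ) • u‖ + ‖P u‖ + ε / max C 1 with hR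
    have hR0 : 0 < R := by positivity
    have hε' : 0 < ε / max C 1 := by positivity
    have hnR : ‖((R⁻¹ : ℝ) : ℂ)‖ = R⁻¹ := by
      rw [Complex.norm_real, Real.norm_of_nonneg (by positivity)]
    have h1 := hC ⟨⟨l, ((R⁻¹ : ℝ) : ℂ) • u, ((R⁻¹ : ℝ) : ℂ) • f⟩, hA.smul _ huf, by
      simp only
      rw [smul_comm, ← smul_sub, norm_smul, hnR, inv_mul_le_one₀ hR0, hR]
      linarith [norm_nonneg (P u)], by
      simp only
      rw [map_smul, norm_smul, hnR, inv_mul_le_one₀ hR0, hR]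
      linarith [norm_nonneg (f - (l : ℂ) • u)]⟩
    simp only [innerSL_apply_norm, norm_smul, hnR] at h1
    rw [inv_mul_le_iff₀ hR0] at h1
    calc ‖u‖ ≤ R * max C 1 := h1.trans (by gcongr; exact le_max_left _ _)
      _ = _ := by rw [hR]; field_simp
  refine ⟨2 * max C 1 ^ 2, by positivity, fun l u f huf => ?_⟩
  calc ‖u‖ ^ 2 ≤ (max C 1 * (‖f - (l : ℂ) • u‖ + ‖P u‖)) ^ 2 := by gcongr; exact hbound l u f huf
    _ ≤ _ := by
      rw [mul_pow]
      nlinarith [mul_nonneg (sq_nonneg (max C 1))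
        (sq_nonneg (‖f - (l : ℂ) • u‖ - ‖P u‖))]

end AbstractControl

/-! ### The self-adjoint operator of a positive semidefinite form -/

section Friedrichs

/-- The Hilbert space completion of a vector space with a positive semidefinite form. -/
theorem exists_hilbert_completion.{v} {V : Type v} [AddCommGroup V] [Module ℂ V]
    (c : PreInnerProductSpace.Core ℂ V) :
    ∃ (K : Type v) (_ : NormedAddCommGroup K) (_ : InnerProductSpace ℂ K) (_ : CompleteSpace K)
      (j : V →ₗ[ℂ] K), DenseRange j ∧ ∀ x y, inner ℂ (j x) (j y) = c.inner x y := by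
  -- The form may be degenerate (constants have zero Dirichlet energy); the Hausdorff completion
  -- also divides out its kernel.
  let _ : SeminormedAddCommGroup V := InnerProductSpace.Core.toSeminormedAddCommGroup (𝕜 := ℂ)
  let _ : InnerProductSpace ℂ V := InnerProductSpace.ofCore c
  refine ⟨UniformSpace.Completion V, inferInstance, inferInstance, inferInstance,
    (UniformSpace.Completion.toComplL : V →L[ℂ] UniformSpace.Completion V).toLinearMap, ?_, ?_⟩
  · exact UniformSpace.Completion.denseRange_coe
  · exact fun x y => UniformSpace.Completion.inner_coe x y

variable {H V : Type*} [NormedAddCommGroup H] [InnerProductSpace ℂ H]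
  [AddCommGroup V] [Module ℂ V]

/-- The graph of (minus) the operator of the form `c`, on the closure of the form domain `V`. -/
def FormGraph (c : PreInnerProductSpace.Core ℂ V) (ι : V →ₗ[ℂ] H) (u f : H) : Prop :=
  ∃ φ : ℕ → V, Tendsto (fun k => ι (φ k)) atTop (𝓝 u) ∧
    Tendsto (fun p : ℕ × ℕ => c.inner (φ p.1 - φ p.2) (φ p.1 - φ p.2)) atTop (𝓝 0) ∧
    ∀ ψ, Tendsto (fun k => c.inner ψ (φ k)) atTop (𝓝 (-inner ℂ (ι ψ) f))

/-- Form-Cauchy sequences converge in the completion `K`, so one vector `w` replaces all limits of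
the form. Closability is not used: `w` is not required to be determined by `u`. -/
theorem formGraph_iff (c : PreInnerProductSpace.Core ℂ V) (ι : V →ₗ[ℂ] H) {K : Type*}
    [NormedAddCommGroup K] [InnerProductSpace ℂ K] [CompleteSpace K] (j : V →ₗ[ℂ] K)
    (hj : ∀ x y, inner ℂ (j x) (j y) = c.inner x y) (u f : H) :
    FormGraph c ι u f ↔ ∃ (φ : ℕ → V) (w : K), Tendsto (fun k => ι (φ k)) atTop (𝓝 u) ∧
      Tendsto (fun k => j (φ k)) atTop (𝓝 w) ∧ ∀ ψ, inner ℂ (j ψ) w = -inner ℂ (ι ψ) f := by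
  have hd : ∀ x y, c.inner (x - y) (x - y) = ((dist (j x) (j y) ^ 2 : ℝ) : ℂ) := fun x y => by
    rw [← hj, inner_self_eq_norm_sq_to_K, map_sub, dist_eq_norm]
    norm_cast
  constructor
  · rintro ⟨φ, h1, h2, h3⟩
    have hC : CauchySeq fun k => j (φ k) := by
      rw [cauchySeq_iff_tendsto_dist_atTop_0]
      simp only [hd] at h2
      have h4 := (Complex.continuous_re.tendsto _).comp h2
      simp only [Function.comp_def, Complex.ofReal_re, Complex.zero_re] at h4
      have h5 := (Real.continuous_sqrt.tendsto _).comp h4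
      simpa [Function.comp_def, Real.sqrt_sq dist_nonneg] using h5
    obtain ⟨w, hw⟩ := cauchySeq_tendsto_of_complete hC
    refine ⟨φ, w, h1, hw, fun ψ => ?_⟩
    refine tendsto_nhds_unique ?_ (h3 ψ)
    simp only [← hj]
    exact tendsto_const_nhds.inner hw
  · rintro ⟨φ, w, h1, h2, h3⟩
    refine ⟨φ, h1, ?_, fun ψ => ?_⟩
    · have h4 := cauchySeq_iff_tendsto_dist_atTop_0.1 h2.cauchySeq
      have h5 := (Complex.continuous_ofReal.tendsto _).comp (h4.pow 2)
      simp only [hd]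
      simpa [Function.comp_def] using h5
    · rw [← h3]
      simp only [← hj]
      exact tendsto_const_nhds.inner h2

/-- The operator of a densely defined positive semidefinite form is self-adjoint. -/
theorem nonposSelfAdjoint_formGraph [CompleteSpace H] (c : PreInnerProductSpace.Core ℂ V) (ι : V →ₗ[ℂ] H)
    (hι : ∀ x, (∀ ψ, inner ℂ (ι ψ) x = 0) → x = 0) : NonposSelfAdjoint (FormGraph c ι) := by
  obtain ⟨K, _, _, _, j, -, hj⟩ := exists_hilbert_completion c
  have hiff := formGraph_iff c ι j hj
  have hpair : ∀ {u f v k : H} {φ χ : ℕ → V} {w z : K},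
      Tendsto (fun k => ι (φ k)) atTop (𝓝 u) → Tendsto (fun k => j (φ k)) atTop (𝓝 w) →
      (∀ ψ, inner ℂ (j ψ) z = -inner ℂ (ι ψ) k) → inner ℂ w z = -inner ℂ u k :=
    fun h1 h2 h3 => tendsto_nhds_unique (h2.inner tendsto_const_nhds) (by
      simp only [h3]
      exact (h1.inner tendsto_const_nhds).neg)
  have hnonpos : ∀ {u f : H}, FormGraph c ι u f → (inner ℂ u f).re ≤ 0 := by
    intro u f h
    obtain ⟨φ, w, h1, h2, h3⟩ := (hiff u f).1 h
    have h4 : inner ℂ u f = -inner ℂ w w := by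
      rw [hpair (f := u) (v := u) (χ := φ) h1 h2 h3, neg_neg]
    rw [h4, Complex.neg_re]
    exact neg_nonpos.2 (inner_self_nonneg (𝕜 := ℂ))
  have hsurj : ∀ a : ℝ, 0 < a → ∀ x, ∃ u, FormGraph c ι u ((a : ℂ) • u - x) := by
    intro a ha x
    have hsa : (0 : ℝ) < Real.sqrt a := Real.sqrt_pos.2 ha
    have hsa' : ((Real.sqrt a : ℝ) : ℂ) ≠ 0 := by exact_mod_cast hsa.ne'
    -- Lax–Milgram by projection: `J ψ = (√a ι ψ, j ψ)` carries the form `a ⟨ι ψ, ι ψ⟩ + c(ψ, ψ)`,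
    -- and projecting `(x / √a, 0)` onto the closed range solves the weak form of `(a - A) u = x`.
    let J : V →ₗ[ℂ] WithLp 2 (H × K) :=
      (WithLp.linearEquiv 2 ℂ (H × K)).symm.toLinearMap ∘ₗ
        ((((Real.sqrt a : ℝ) : ℂ) • ι).prod j)
    let W : Submodule ℂ (WithLp 2 (H × K)) := (LinearMap.range J).topologicalClosure
    have hWc : CompleteSpace W :=
      (Submodule.isClosed_topologicalClosure _).completeSpace_coe
    set y : WithLp 2 (H × K) := WithLp.toLp 2 ((((Real.sqrt a)⁻¹ : ℝ) : ℂ) • x, 0) with hy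
    set w : WithLp 2 (H × K) := W.starProjection y with hw
    have hwW : w ∈ W := Submodule.starProjection_apply_mem _ _
    have horth : ∀ ψ, inner ℂ (J ψ) w = inner ℂ (J ψ) y := fun ψ => by
      have h1 : y - w ∈ Wᗮ := Submodule.sub_starProjection_mem_orthogonal _
      have h2 := h1 (J ψ) (Submodule.le_topologicalClosure _ (LinearMap.mem_range_self J ψ))
      rw [inner_sub_right, sub_eq_zero] at h2
      exact h2.symm
    have hfirst : FirstCountableTopology (WithLp 2 (H × K)) :=
      UniformSpace.firstCountableTopology _
    obtain ⟨s, hs, hsw⟩ := mem_closure_iff_seq_limit.1 hwW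
    choose φ hφ using hs
    have hlim : Tendsto (fun k => J (φ k)) atTop (𝓝 w) := by simpa only [hφ] using hsw
    have hl1 : Tendsto (fun k => ((Real.sqrt a : ℝ) : ℂ) • ι (φ k)) atTop (𝓝 w.fst) :=
      ((WithLp.prod_continuous_ofLp 2 H K).fst.tendsto w).comp hlim
    have hl2 : Tendsto (fun k => j (φ k)) atTop (𝓝 w.snd) :=
      ((WithLp.prod_continuous_ofLp 2 H K).snd.tendsto w).comp hlim
    obtain ⟨u, hwu⟩ : ∃ u : H, w.fst = ((Real.sqrt a : ℝ) : ℂ) • u :=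
      ⟨((Real.sqrt a : ℝ) : ℂ)⁻¹ • w.fst, by rw [smul_inv_smul₀ hsa']⟩
    refine ⟨u, (hiff _ _).2 ⟨φ, w.snd, ?_, hl2, fun ψ => ?_⟩⟩
    · rw [hwu] at hl1
      simpa only [inv_smul_smul₀ hsa'] using hl1.const_smul ((Real.sqrt a : ℝ) : ℂ)⁻¹
    · have h1 := horth ψ
      simp only [WithLp.prod_inner_apply] at h1
      change inner ℂ (((Real.sqrt a : ℝ) : ℂ) • ι ψ) w.fst + inner ℂ (j ψ) w.snd =
        inner ℂ (((Real.sqrt a : ℝ) : ℂ) • ι ψ) ((((Real.sqrt a)⁻¹ : ℝ) : ℂ) • x) +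
          inner ℂ (j ψ) 0 at h1
      have h2 : ((Real.sqrt a : ℝ) : ℂ) * ((Real.sqrt a : ℝ) : ℂ) = a := by
        rw [← Complex.ofReal_mul, Real.mul_self_sqrt ha.le]
      rw [hwu, inner_smul_left, inner_smul_right, inner_smul_left, inner_smul_right,
        inner_zero_right, Complex.conj_ofReal, ← mul_assoc, h2, ← mul_assoc, Complex.ofReal_inv,
        mul_inv_cancel₀ hsa', one_mul, add_zero] at h1
      rw [inner_sub_right, inner_smul_right]
      linear_combination h1
  refine ⟨?_, ?_, ?_, hnonpos, hsurj, ?_⟩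
  · intro u f v k h h'
    obtain ⟨φ, w, h1, h2, h3⟩ := (hiff u f).1 h
    obtain ⟨χ, z, h1', h2', h3'⟩ := (hiff v k).1 h'
    refine (hiff _ _).2 ⟨φ + χ, w + z, ?_, ?_, fun ψ => ?_⟩
    · simpa using h1.add h1'
    · simpa using h2.add h2'
    · rw [inner_add_right, inner_add_right, h3, h3', neg_add]
  · intro u f a h
    obtain ⟨φ, w, h1, h2, h3⟩ := (hiff u f).1 h
    refine (hiff _ _).2 ⟨a • φ, a • w, ?_, ?_, fun ψ => ?_⟩
    · simpa using h1.const_smul a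
    · simpa using h2.const_smul a
    · rw [inner_smul_right, inner_smul_right, h3, mul_neg]
  · intro u f v k h h'
    obtain ⟨φ, w, h1, h2, h3⟩ := (hiff u f).1 h
    obtain ⟨χ, z, h1', h2', h3'⟩ := (hiff v k).1 h'
    have h4 := hpair (f := u) (v := u) (χ := φ) h1 h2 h3'
    have h5 := hpair (f := u) (v := u) (χ := φ) h1' h2' h3
    rw [← inner_conj_symm, ← neg_neg (inner ℂ v f), ← h5, map_neg, inner_conj_symm, h4, neg_neg]
  · intro x hx
    -- If `x` is orthogonal to the domain and `u - A u = x`, then `⟨u, A u⟩ = ‖u‖² ≤ 0`, so `u = 0`;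
    -- then its form vector `w` vanishes too, and `x` is orthogonal to the range of `ι`.
    obtain ⟨u, hu⟩ := hsurj 1 one_pos x
    have hu0 : u = 0 := by
      have h1 := hnonpos hu
      rw [Complex.ofReal_one, one_smul, inner_sub_right, hx u _ hu, sub_zero,
        inner_self_eq_norm_sq_to_K] at h1
      have h2 : ‖u‖ ^ 2 ≤ 0 := by exact_mod_cast h1
      exact norm_eq_zero.1 (pow_eq_zero_iff two_ne_zero |>.1 (le_antisymm h2 (by positivity)))
    rw [hu0, smul_zero, zero_sub] at hu
    obtain ⟨φ, w, h1, h2, h3⟩ := (hiff _ _).1 hu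
    have h4 := hpair (f := u) (v := u) (χ := φ) h1 h2 h3
    rw [inner_zero_left, neg_zero, inner_self_eq_zero] at h4
    refine hι x fun ψ => ?_
    have h5 := h3 ψ
    rw [h4, inner_zero_right, inner_neg_right, neg_neg] at h5
    exact h5.symm

end Friedrichs

/-! ### Change of charts for the metric -/

section Charts

variable {n : ℕ} {X : Type*} [TopologicalSpace X] [ChartedSpace (EuclideanSpace ℝ (Fin n)) X]

/-- The preferred chart at `x₀`. -/
local notation "chart" => chartAt (EuclideanSpace ℝ (Fin n))

/-- The transition map between the preferred charts at `x₀` and `x₁`. -/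
def transition (x₀ x₁ : X) : EuclideanSpace ℝ (Fin n) → EuclideanSpace ℝ (Fin n) :=
  fun y => chart x₁ ((chart x₀).symm y)

/-- The Jacobian matrix of the transition map. -/
noncomputable def jacobian (x₀ x₁ : X) (y : EuclideanSpace ℝ (Fin n)) : Matrix (Fin n) (Fin n) ℝ :=
  Matrix.of fun i j => fderiv ℝ (transition x₀ x₁) y (EuclideanSpace.single j 1) i

theorem isOpen_transition_domain (x₀ x₁ : X) :
    IsOpen ((chart x₀).target ∩ (chart x₀).symm ⁻¹' (chart x₁).source) :=
  (chart x₀).isOpen_inter_preimage_symm (chart x₁).open_source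

theorem fderiv_transition_single (x₀ x₁ : X) (y : EuclideanSpace ℝ (Fin n)) (i : Fin n) :
    fderiv ℝ (transition x₀ x₁) y (EuclideanSpace.single i 1) =
      ∑ k, jacobian x₀ x₁ y k i • EuclideanSpace.single k (1 : ℝ) := by
  have h := (EuclideanSpace.basisFun (Fin n) ℝ).sum_repr
    (fderiv ℝ (transition x₀ x₁) y (EuclideanSpace.single i 1))
  simpa [jacobian] using h.symm

theorem det_jacobian (x₀ x₁ : X) (y : EuclideanSpace ℝ (Fin n)) :
    (jacobian x₀ x₁ y).det = (fderiv ℝ (transition x₀ x₁) y).det := by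
  rw [ContinuousLinearMap.det, ← LinearMap.det_toMatrix (EuclideanSpace.basisFun (Fin n) ℝ).toBasis]
  congr 1

theorem transition_mem {x₀ x₁ : X} {y : EuclideanSpace ℝ (Fin n)}
    (hy' : (chart x₀).symm y ∈ (chart x₁).source) : transition x₀ x₁ y ∈ (chart x₁).target :=
  (chart x₁).map_source hy'

theorem symm_eventuallyEq_transition {x₀ x₁ : X} {y : EuclideanSpace ℝ (Fin n)}
    (hy : y ∈ (chart x₀).target) (hy' : (chart x₀).symm y ∈ (chart x₁).source) :
    (chart x₀).symm =ᶠ[𝓝 y] (chart x₁).symm ∘ transition x₀ x₁ := by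
  filter_upwards [(isOpen_transition_domain x₀ x₁).mem_nhds ⟨hy, hy'⟩] with z hz
  exact ((chart x₁).left_inv hz.2).symm

theorem transition_image {x₀ x₁ : X} {B : Set X} (h0 : B ⊆ (chart x₀).source)
    (h1 : B ⊆ (chart x₁).source) :
    transition x₀ x₁ '' ((chart x₀).target ∩ (chart x₀).symm ⁻¹' B) =
      (chart x₁).target ∩ (chart x₁).symm ⁻¹' B := by
  ext z
  constructor
  · rintro ⟨y, ⟨hy, hyB⟩, rfl⟩
    refine ⟨(chart x₁).map_source (h1 hyB), ?_⟩
    have : (chart x₁).symm (transition x₀ x₁ y) = (chart x₀).symm y := (chart x₁).left_inv (h1 hyB)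
    rwa [mem_preimage, this]
  · rintro ⟨hz, hzB⟩
    refine ⟨chart x₀ ((chart x₁).symm z), ⟨(chart x₀).map_source (h0 hzB), ?_⟩, ?_⟩
    · rwa [mem_preimage, (chart x₀).left_inv (h0 hzB)]
    · rw [transition, (chart x₀).left_inv (h0 hzB), (chart x₁).right_inv hz]

variable [IsManifold (𝓡 n) ∞ X]

theorem contMDiffOn_transition (x₀ x₁ : X) :
    ContMDiffOn (𝓡 n) (𝓡 n) ∞ (transition x₀ x₁)
      ((chart x₀).target ∩ (chart x₀).symm ⁻¹' (chart x₁).source) :=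
  contMDiffOn_chart.comp (contMDiffOn_chart_symm.mono inter_subset_left) inter_subset_right

theorem differentiableAt_transition {x₀ x₁ : X} {y : EuclideanSpace ℝ (Fin n)}
    (hy : y ∈ (chart x₀).target) (hy' : (chart x₀).symm y ∈ (chart x₁).source) :
    DifferentiableAt ℝ (transition x₀ x₁) y :=
  ((contMDiffOn_transition x₀ x₁).contDiffOn.contDiffAt
    ((isOpen_transition_domain x₀ x₁).mem_nhds ⟨hy, hy'⟩)).differentiableAt (by simp)

theorem mdifferentiableAt_chart_symm {x₀ : X} {y : EuclideanSpace ℝ (Fin n)}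
    (hy : y ∈ (chart x₀).target) : MDifferentiableAt (𝓡 n) (𝓡 n) (chart x₀).symm y :=
  ((contMDiffOn_chart_symm (n := ∞) (I := 𝓡 n)).contMDiffAt
    ((chart x₀).open_target.mem_nhds hy)).mdifferentiableAt (by simp)

/-- The coordinate vector field, with values in the model space. -/
noncomputable def coordVecModel (x₀ : X) (y : EuclideanSpace ℝ (Fin n)) (i : Fin n) :
    EuclideanSpace ℝ (Fin n) :=
  coordVec x₀ y i

/-- The metric at `x`, on the model space. -/
noncomputable def innerModel (g : Metric n X) (x : X) :
    EuclideanSpace ℝ (Fin n) →L[ℝ] EuclideanSpace ℝ (Fin n) →L[ℝ] ℝ :=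
  g.inner x

theorem metricMatrix_apply (g : Metric n X) (x₀ : X) (y : EuclideanSpace ℝ (Fin n)) (i j : Fin n) :
    metricMatrix g x₀ y i j =
      innerModel g ((chart x₀).symm y) (coordVecModel x₀ y i) (coordVecModel x₀ y j) :=
  rfl

theorem coordVecModel_transition {x₀ x₁ : X} {y : EuclideanSpace ℝ (Fin n)}
    (hy : y ∈ (chart x₀).target) (hy' : (chart x₀).symm y ∈ (chart x₁).source) (i : Fin n) :
    coordVecModel x₀ y i =
      ∑ k, jacobian x₀ x₁ y k i • coordVecModel x₁ (transition x₀ x₁ y) k := by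
  have hd := differentiableAt_transition hy hy'
  have h1 : mfderiv (𝓡 n) (𝓡 n) (chart x₀).symm y =
      mfderiv (𝓡 n) (𝓡 n) ((chart x₁).symm ∘ transition x₀ x₁) y :=
    (symm_eventuallyEq_transition hy hy').mfderiv_eq
  have h2 := mfderiv_comp y (mdifferentiableAt_chart_symm (transition_mem hy'))
    hd.mdifferentiableAt
  rw [mfderiv_eq_fderiv] at h2
  obtain ⟨D, hD⟩ : ∃ D : EuclideanSpace ℝ (Fin n) →L[ℝ] EuclideanSpace ℝ (Fin n),
      D = mfderiv (𝓡 n) (𝓡 n) (chart x₁).symm (transition x₀ x₁ y) := ⟨_, rfl⟩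
  have hDk : ∀ k, coordVecModel x₁ (transition x₀ x₁ y) k = D (EuclideanSpace.single k 1) :=
    fun k => by rw [hD]; rfl
  have h3 : coordVecModel x₀ y i =
      D (fderiv ℝ (transition x₀ x₁) y (EuclideanSpace.single i 1)) := by
    rw [hD]
    exact congrArg (fun L : EuclideanSpace ℝ (Fin n) →L[ℝ] EuclideanSpace ℝ (Fin n) =>
      L (EuclideanSpace.single i (1 : ℝ))) (h1.trans h2)
  simp only [h3, fderiv_transition_single, map_sum, map_smul, hDk]

theorem metricMatrix_transition (g : Metric n X) {x₀ x₁ : X} {y : EuclideanSpace ℝ (Fin n)}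
    (hy : y ∈ (chart x₀).target) (hy' : (chart x₀).symm y ∈ (chart x₁).source) :
    metricMatrix g x₀ y = (jacobian x₀ x₁ y).transpose *
      metricMatrix g x₁ (transition x₀ x₁ y) * jacobian x₀ x₁ y := by
  ext i j
  have hp : (chart x₁).symm (transition x₀ x₁ y) = (chart x₀).symm y := (chart x₁).left_inv hy'
  rw [metricMatrix_apply, coordVecModel_transition hy hy' i, coordVecModel_transition hy hy' j]
  simp only [Matrix.mul_apply, Matrix.transpose_apply, metricMatrix_apply, hp, map_sum, map_smul,
    sum_apply, smul_apply, smul_eq_mul, Finset.sum_mul, Finset.mul_sum]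
  refine Finset.sum_congr rfl fun k _ => Finset.sum_congr rfl fun l _ => ?_
  ring

/-- The differential of the inverse chart is injective on the target, so this is the Gram matrix of
independent vectors. -/
theorem posDef_metricMatrix (g : Metric n X) {x₀ : X} {y : EuclideanSpace ℝ (Fin n)}
    (hy : y ∈ (chart x₀).target) : (metricMatrix g x₀ y).PosDef := by
  refine Matrix.PosDef.of_dotProduct_mulVec_pos ?_ fun v hv => ?_
  · ext i j
    simp only [Matrix.conjTranspose_apply, star_trivial]
    exact g.symm _ _ _
  · set D : EuclideanSpace ℝ (Fin n) →L[ℝ] EuclideanSpace ℝ (Fin n) :=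
      mfderiv (𝓡 n) (𝓡 n) (chart x₀).symm y with hD
    have hinj : Function.Injective D :=
      (mdifferentiable_chart (I := 𝓡 n) x₀).symm.mfderiv_injective hy
    set w : EuclideanSpace ℝ (Fin n) := ∑ i, v i • EuclideanSpace.single i (1 : ℝ) with hw
    have hw0 : w ≠ 0 := by
      intro h
      apply hv
      ext i
      have := congrArg (fun z : EuclideanSpace ℝ (Fin n) => z i) h
      simpa [hw, Finset.sum_apply, PiLp.single_apply, Pi.single_apply] using this
    have hDw : D w = ∑ i, v i • coordVecModel x₀ y i := by
      rw [hw, map_sum]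
      simp only [map_smul]
      rfl
    have hpos : 0 < innerModel g ((chart x₀).symm y) (D w) (D w) :=
      g.pos _ (D w) fun h => hw0 (hinj (h.trans (map_zero D).symm))
    refine hpos.trans_eq ?_
    rw [hDw]
    simp only [star_trivial, dotProduct, Matrix.mulVec, metricMatrix_apply, map_sum, map_smul,
      sum_apply, smul_apply, smul_eq_mul, Finset.mul_sum]
    rw [Finset.sum_comm]
    refine Finset.sum_congr rfl fun k _ => Finset.sum_congr rfl fun l _ => ?_
    ring

theorem det_metricMatrix_transition (g : Metric n X) {x₀ x₁ : X} {y : EuclideanSpace ℝ (Fin n)}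
    (hy : y ∈ (chart x₀).target) (hy' : (chart x₀).symm y ∈ (chart x₁).source) :
    (metricMatrix g x₀ y).det =
      (jacobian x₀ x₁ y).det ^ 2 * (metricMatrix g x₁ (transition x₀ x₁ y)).det := by
  rw [metricMatrix_transition g hy hy', Matrix.det_mul, Matrix.det_mul, Matrix.det_transpose]
  ring

/-- Inverting `g₀ = Jᵀ g₁ J`; the Jacobian is invertible since `det g₀ ≠ 0`. -/
theorem inv_metricMatrix_transition (g : Metric n X) {x₀ x₁ : X} {y : EuclideanSpace ℝ (Fin n)}
    (hy : y ∈ (chart x₀).target) (hy' : (chart x₀).symm y ∈ (chart x₁).source) :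
    jacobian x₀ x₁ y * (metricMatrix g x₀ y)⁻¹ * (jacobian x₀ x₁ y).transpose =
      (metricMatrix g x₁ (transition x₀ x₁ y))⁻¹ := by
  have hJ : IsUnit (jacobian x₀ x₁ y).det := by
    rw [isUnit_iff_ne_zero]
    intro h
    have := det_metricMatrix_transition g hy hy'
    rw [h] at this
    simp [(posDef_metricMatrix g hy).det_pos.ne'] at this
  have hJt : IsUnit (jacobian x₀ x₁ y).transpose.det := by rwa [Matrix.det_transpose]
  rw [metricMatrix_transition g hy hy', Matrix.mul_inv_rev, Matrix.mul_inv_rev, ← mul_assoc,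
    Matrix.mul_nonsing_inv _ hJ, one_mul, mul_assoc, Matrix.nonsing_inv_mul _ hJt, mul_one]

theorem continuousOn_coordVec (x₀ : X) (i : Fin n) :
    ContinuousOn (fun y => TotalSpace.mk' (EuclideanSpace ℝ (Fin n))
      (E := fun x : X => TangentSpace (𝓡 n) x) ((chart x₀).symm y) (coordVec x₀ y i))
      (chart x₀).target := by
  have h1 := (contMDiffOn_chart_symm (n := ∞) (I := 𝓡 n) (x := x₀)).continuousOn_tangentMapWithin
    (by simp) (chart x₀).open_target.uniqueMDiffOn
  have h2 : Continuous fun y : EuclideanSpace ℝ (Fin n) =>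
      (⟨y, EuclideanSpace.single i (1 : ℝ)⟩ : TangentBundle (𝓡 n) (EuclideanSpace ℝ (Fin n))) :=
    (tangentBundleModelSpaceHomeomorph (𝓡 n)).symm.continuous.comp
      (continuous_id.prodMk continuous_const)
  refine (h1.comp h2.continuousOn fun y hy => hy).congr fun y hy => ?_
  simp only [Function.comp_apply, tangentMapWithin,
    mfderivWithin_of_mem_nhds ((chart x₀).open_target.mem_nhds hy)]
  rfl

theorem continuousOn_metricMatrix (g : Metric n X) (x₀ : X) :
    ContinuousOn (metricMatrix g x₀) (chart x₀).target := by
  refine continuousOn_pi.2 fun i => continuousOn_pi.2 fun j => ?_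
  have h : ContinuousOn (fun y => TotalSpace.mk' ℝ (E := Bundle.Trivial X ℝ) ((chart x₀).symm y)
      (g.inner ((chart x₀).symm y) (coordVec x₀ y i) (coordVec x₀ y j))) (chart x₀).target :=
    ContinuousOn.clm_bundle_apply₂ (F₁ := EuclideanSpace ℝ (Fin n))
      (F₂ := EuclideanSpace ℝ (Fin n))
      (g.contMDiff.continuous.comp_continuousOn (chart x₀).continuousOn_symm)
      (continuousOn_coordVec x₀ i) (continuousOn_coordVec x₀ j)
  intro y hy
  have := h y hy
  rw [FiberBundle.continuousWithinAt_totalSpace] at this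
  exact this.2

theorem continuousOn_inv_metricMatrix (g : Metric n X) (x₀ : X) :
    ContinuousOn (fun y => (metricMatrix g x₀ y)⁻¹) (chart x₀).target := by
  intro y hy
  refine ContinuousAt.comp_continuousWithinAt (g := fun M : Matrix (Fin n) (Fin n) ℝ => M⁻¹) ?_
    (continuousOn_metricMatrix g x₀ y hy)
  simp only [Matrix.inv_def, Ring.inverse_eq_inv']
  exact ((continuous_id.matrix_det.continuousAt).inv₀ (posDef_metricMatrix g hy).det_pos.ne').smul
    continuous_id.matrix_adjugate.continuousAt

/-- The density of the Riemannian volume in the preferred chart at `x₀`. -/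
noncomputable def volumeDensity (g : Metric n X) (x₀ : X) (y : EuclideanSpace ℝ (Fin n)) : ℝ≥0∞ :=
  ENNReal.ofReal (Real.sqrt (metricMatrix g x₀ y).det)

theorem volumeDensity_transition (g : Metric n X) {x₀ x₁ : X} {y : EuclideanSpace ℝ (Fin n)}
    (hy : y ∈ (chart x₀).target) (hy' : (chart x₀).symm y ∈ (chart x₁).source) :
    volumeDensity g x₀ y = ENNReal.ofReal |(fderiv ℝ (transition x₀ x₁) y).det| *
      volumeDensity g x₁ (transition x₀ x₁ y) := by
  rw [volumeDensity, volumeDensity, det_metricMatrix_transition g hy hy', det_jacobian,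
    Real.sqrt_mul (sq_nonneg _), Real.sqrt_sq_eq_abs, ENNReal.ofReal_mul (abs_nonneg _)]

end Charts

/-! ### Finiteness of the Riemannian volume -/

section Volume

variable {n : ℕ} {X : Type*} [TopologicalSpace X] [ChartedSpace (EuclideanSpace ℝ (Fin n)) X]
  [MeasurableSpace X] [BorelSpace X]

local notation "chart" => chartAt (EuclideanSpace ℝ (Fin n))

theorem measurableSet_chart_preimage (x₀ : X) {B : Set X} (hB : MeasurableSet B) :
    MeasurableSet ((chart x₀).target ∩ (chart x₀).symm ⁻¹' B) := by
  have h1 : Measurable ((chart x₀).target.domRestrict (chart x₀).symm) :=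
    ((chart x₀).continuousOn_symm.domRestrict).measurable
  have h2 := (chart x₀).open_target.measurableSet.subtype_image (h1 hB)
  convert h2 using 1
  ext y
  simp [and_comm]

variable [IsManifold (𝓡 n) ∞ X]

theorem chartVolume_apply (g : Metric n X) (x₀ : X) {B : Set X} (hB : MeasurableSet B) :
    chartVolume g x₀ B =
      ∫⁻ y in (chart x₀).target ∩ (chart x₀).symm ⁻¹' B, volumeDensity g x₀ y := by
  have hm : MeasurableSet (chart x₀).target := (chart x₀).open_target.measurableSet
  have hae : AEMeasurable (chart x₀).symm (volume.restrict (chart x₀).target) :=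
    (chart x₀).continuousOn_symm.aemeasurable hm
  rw [chartVolume, Measure.map_apply_of_aemeasurable
    (hae.mono_ac (withDensity_absolutelyContinuous _ _)) hB, withDensity_apply',
    Measure.restrict_restrict' hm, inter_comm]
  rfl

theorem chartVolume_inter_source (g : Metric n X) (x₀ : X) {B : Set X} (hB : MeasurableSet B) :
    chartVolume g x₀ (B ∩ (chart x₀).source) = chartVolume g x₀ B := by
  rw [chartVolume_apply g x₀ hB,
    chartVolume_apply g x₀ (hB.inter (chart x₀).open_source.measurableSet)]
  congr 2
  ext y
  simp only [mem_inter_iff, mem_preimage, and_congr_right_iff, and_iff_left_iff_imp]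
  exact fun hy _ => (chart x₀).map_target hy

/-- The local expressions of the Riemannian volume agree on the overlaps of charts. -/
theorem chartVolume_eq (g : Metric n X) {x₀ x₁ : X} {B : Set X} (hB : MeasurableSet B)
    (h0 : B ⊆ (chart x₀).source) (h1 : B ⊆ (chart x₁).source) :
    chartVolume g x₀ B = chartVolume g x₁ B := by
  have hm := measurableSet_chart_preimage (n := n) x₀ hB
  rw [chartVolume_apply g x₀ hB, chartVolume_apply g x₁ hB, ← transition_image h0 h1,
    lintegral_image_eq_lintegral_abs_det_fderiv_mul volume hm
      (fun y hy => (differentiableAt_transition hy.1 (h1 hy.2)).hasFDerivAt.hasFDerivWithinAt)]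
  · exact setLIntegral_congr_fun hm fun y hy => volumeDensity_transition g hy.1 (h1 hy.2)
  · intro y hy z hz hyz
    have h2 : (chart x₀).symm y = (chart x₀).symm z :=
      (chart x₁).injOn (h1 hy.2) (h1 hz.2) hyz
    exact (chart x₀).symm.injOn hy.1 hz.1 h2

theorem chartVolume_lt_top [T2Space X] (g : Metric n X) (x₀ : X) {K : Set X} (hK : IsCompact K)
    (hKs : K ⊆ (chart x₀).source) : chartVolume g x₀ K < ⊤ := by
  have himg : (chart x₀).target ∩ (chart x₀).symm ⁻¹' K = chart x₀ '' K := by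
    rw [← (chart x₀).image_source_inter_eq' K, inter_eq_right.2 hKs]
  have hc : IsCompact (chart x₀ '' K) := hK.image_of_continuousOn ((chart x₀).continuousOn.mono hKs)
  have hsub : chart x₀ '' K ⊆ (chart x₀).target := by
    rw [← himg]; exact inter_subset_left
  rw [chartVolume_apply g x₀ hK.measurableSet, himg]
  have hcont : ContinuousOn (fun y => Real.sqrt (metricMatrix g x₀ y).det) (chart x₀ '' K) :=
    (Real.continuous_sqrt.comp continuous_id.matrix_det).comp_continuousOn
      ((continuousOn_metricMatrix g x₀).mono hsub)
  obtain ⟨C, hC⟩ := hc.exists_bound_of_continuousOn hcont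
  refine (setLIntegral_mono' hc.measurableSet (g := fun _ => ENNReal.ofReal C) fun y hy =>
    ENNReal.ofReal_le_ofReal ((le_abs_self _).trans (hC y hy))).trans_lt ?_
  rw [setLIntegral_const]
  exact ENNReal.mul_lt_top ENNReal.ofReal_lt_top hc.measure_lt_top

instance isFiniteMeasure_riemVolume [CompactSpace X] [T2Space X] (g : Metric n X) :
    IsFiniteMeasure (riemVolume g) := by
  have hloc : LocallyCompactSpace X :=
    ChartedSpace.locallyCompactSpace (EuclideanSpace ℝ (Fin n)) X
  have hK : ∀ x : X, ∃ K : Set X, IsCompact K ∧ x ∈ interior K ∧ K ⊆ (chart x).source := fun x =>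
    exists_compact_subset (chart x).open_source (mem_chart_source _ x)
  choose K hKc hKx hKs using hK
  obtain ⟨t, ht⟩ := isCompact_univ.elim_finite_subcover (fun x => interior (K x))
    (fun x => isOpen_interior) (fun x _ => mem_iUnion.2 ⟨x, hKx x⟩)
  -- The supremum over all charts is controlled by finitely many compact pieces: on each piece any
  -- chart volume, which lives on its own chart domain, agrees with that of the chart containing the
  -- piece.
  have hle : riemVolume g ≤ ∑ x ∈ t, (chartVolume g x).restrict (K x) := by
    refine iSup_le fun x₀ => Measure.le_iff.2 fun B hB => ?_
    have hcover : B ⊆ ⋃ x ∈ t, B ∩ K x := fun z hz => by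
      obtain ⟨x, hx, hzx⟩ := mem_iUnion₂.1 (ht (mem_univ z))
      exact mem_iUnion₂.2 ⟨x, hx, hz, interior_subset hzx⟩
    rw [Measure.finsetSum_apply]
    refine (measure_mono hcover).trans ((measure_biUnion_finset_le t _).trans
      (Finset.sum_le_sum fun x _ => ?_))
    have hm : MeasurableSet (B ∩ K x) := hB.inter (hKc x).measurableSet
    rw [Measure.restrict_apply hB, ← chartVolume_inter_source g x₀ hm]
    rw [chartVolume_eq g (x₁ := x) (hm.inter (chart x₀).open_source.measurableSet)
      inter_subset_right (inter_subset_left.trans (inter_subset_right.trans (hKs x)))]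
    exact measure_mono inter_subset_left
  refine ⟨(hle univ).trans_lt ?_⟩
  rw [Measure.finsetSum_apply]
  refine ENNReal.sum_lt_top.2 fun x _ => ?_
  rw [Measure.restrict_apply_univ]
  exact chartVolume_lt_top g x (hKc x) (hKs x)

end Volume

/-! ### Chart independence, continuity and positivity of the gradient pairing -/

section Gradient

variable {n : ℕ} {X : Type*} [TopologicalSpace X] [ChartedSpace (EuclideanSpace ℝ (Fin n)) X]

local notation "chart" => chartAt (EuclideanSpace ℝ (Fin n))

/-- The partial derivatives of `φ` in the preferred chart at `x₀`. -/
noncomputable def partialIn (x₀ : X) (φ : X → ℂ) (y : EuclideanSpace ℝ (Fin n)) (i : Fin n) : ℂ :=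
  fderiv ℝ (φ ∘ (chart x₀).symm) y (EuclideanSpace.single i (1 : ℝ))

variable [IsManifold (𝓡 n) ∞ X]

/-- The inverse of the metric matrix, as a complex matrix. -/
noncomputable def cometric (g : Metric n X) (x₀ : X) (y : EuclideanSpace ℝ (Fin n)) :
    Matrix (Fin n) (Fin n) ℂ :=
  (metricMatrix g x₀ y)⁻¹.map (fun r : ℝ => (r : ℂ))

/-- The pairing of the gradients of `φ` and `ψ` in the preferred chart at `x₀`. -/
noncomputable def gradIn (g : Metric n X) (x₀ : X) (φ ψ : X → ℂ) (y : EuclideanSpace ℝ (Fin n)) :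
    ℂ :=
  star (partialIn x₀ φ y) ⬝ᵥ (cometric g x₀ y).mulVec (partialIn x₀ ψ y)

theorem gradInner_eq_gradIn (g : Metric n X) (φ ψ : X → ℂ) (x : X) :
    gradInner g φ ψ x = gradIn g x φ ψ (chart x x) := by
  simp only [gradInner, gradIn, dotProduct, Matrix.mulVec, Finset.mul_sum, cometric,
    Matrix.map_apply, Pi.star_apply]
  refine Finset.sum_congr rfl fun i _ => Finset.sum_congr rfl fun j _ => ?_
  change _ * (starRingEnd ℂ (partialIn x φ (chart x x) i) * partialIn x ψ (chart x x) j) = _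
  rw [starRingEnd_apply]
  ring

theorem Smooth.contDiffOn {φ : X → ℂ} (hφ : Smooth (n := n) φ) (x₀ : X) :
    ContDiffOn ℝ ∞ (φ ∘ (chart x₀).symm) (chart x₀).target := by
  have h : ContMDiffOn (𝓡 n) 𝓘(ℝ, ℂ) ∞ (φ ∘ (chart x₀).symm) (chart x₀).target :=
    ContMDiff.comp_contMDiffOn hφ contMDiffOn_chart_symm
  exact h.contDiffOn

theorem Smooth.differentiableAt {φ : X → ℂ} (hφ : Smooth (n := n) φ) {x₀ : X}
    {y : EuclideanSpace ℝ (Fin n)} (hy : y ∈ (chart x₀).target) :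
    DifferentiableAt ℝ (φ ∘ (chart x₀).symm) y :=
  ((hφ.contDiffOn x₀).contDiffAt ((chart x₀).open_target.mem_nhds hy)).differentiableAt (by simp)

theorem Smooth.continuousOn_partialIn {φ : X → ℂ} (hφ : Smooth (n := n) φ) (x₀ : X) :
    ContinuousOn (partialIn x₀ φ) (chart x₀).target := by
  refine continuousOn_pi.2 fun i => ?_
  exact ((hφ.contDiffOn x₀).continuousOn_fderiv_of_isOpen (chart x₀).open_target
    (by simp)).clm_apply continuousOn_const

theorem Smooth.partialIn_transition {φ : X → ℂ} (hφ : Smooth (n := n) φ) {x₀ x₁ : X}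
    {y : EuclideanSpace ℝ (Fin n)}
    (hy : y ∈ (chart x₀).target) (hy' : (chart x₀).symm y ∈ (chart x₁).source) :
    partialIn x₀ φ y = ((jacobian x₀ x₁ y).transpose.map (fun r : ℝ => (r : ℂ))).mulVec
      (partialIn x₁ φ (transition x₀ x₁ y)) := by
  ext i
  have h1 : fderiv ℝ (φ ∘ (chart x₀).symm) y =
      fderiv ℝ ((φ ∘ (chart x₁).symm) ∘ transition x₀ x₁) y := by
    refine Filter.EventuallyEq.fderiv_eq ?_
    filter_upwards [symm_eventuallyEq_transition hy hy'] with z hz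
    simp only [Function.comp_apply] at hz ⊢
    rw [hz]
  rw [partialIn, h1, fderiv_comp y (hφ.differentiableAt (transition_mem hy'))
    (differentiableAt_transition hy hy'), ContinuousLinearMap.comp_apply,
    fderiv_transition_single, map_sum]
  simp only [map_smul, Matrix.mulVec, dotProduct, Matrix.map_apply, Matrix.transpose_apply,
    Complex.real_smul]
  rfl

/-- Differentials pick up `Jᵀ` and the cometric transforms by `J · Jᵀ`, so the Jacobians cancel. -/
theorem gradIn_transition (g : Metric n X) {φ ψ : X → ℂ} (hφ : Smooth (n := n) φ)
    (hψ : Smooth (n := n) ψ) {x₀ x₁ : X} {y : EuclideanSpace ℝ (Fin n)}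
    (hy : y ∈ (chart x₀).target) (hy' : (chart x₀).symm y ∈ (chart x₁).source) :
    gradIn g x₀ φ ψ y = gradIn g x₁ φ ψ (transition x₀ x₁ y) := by
  have hmap : ∀ A B : Matrix (Fin n) (Fin n) ℝ, (A * B).map (fun r : ℝ => (r : ℂ)) =
      A.map (fun r : ℝ => (r : ℂ)) * B.map (fun r : ℝ => (r : ℂ)) := fun A B =>
    Matrix.map_mul (f := Complex.ofRealHom)
  have hstar : ((jacobian x₀ x₁ y).transpose.map (fun r : ℝ => (r : ℂ))).conjTranspose =
      (jacobian x₀ x₁ y).map (fun r : ℝ => (r : ℂ)) := by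
    ext i j
    simp
  rw [gradIn, gradIn, hφ.partialIn_transition hy hy', hψ.partialIn_transition hy hy',
    Matrix.star_mulVec, hstar, ← Matrix.dotProduct_mulVec, Matrix.mulVec_mulVec,
    Matrix.mulVec_mulVec, cometric, cometric, ← inv_metricMatrix_transition g hy hy', hmap, hmap,
    mul_assoc]

theorem continuousOn_gradIn (g : Metric n X) {φ ψ : X → ℂ} (hφ : Smooth (n := n) φ)
    (hψ : Smooth (n := n) ψ) (x₀ : X) :
    ContinuousOn (gradIn g x₀ φ ψ) (chart x₀).target := by
  have hN : ContinuousOn (cometric g x₀) (chart x₀).target :=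
    (continuous_id.matrix_map Complex.continuous_ofReal).comp_continuousOn
      (continuousOn_inv_metricMatrix g x₀)
  have hφ' := hφ.continuousOn_partialIn x₀
  have hψ' := hψ.continuousOn_partialIn x₀
  have heq : gradIn g x₀ φ ψ = fun y => ∑ i, star (partialIn x₀ φ y i) *
      ∑ j, cometric g x₀ y i j * partialIn x₀ ψ y j := rfl
  rw [heq]
  refine continuousOn_finsetSum _ fun i _ => ContinuousOn.mul ?_ ?_
  · exact (continuousOn_pi.1 hφ' i).star
  · refine continuousOn_finsetSum _ fun j _ => ContinuousOn.mul ?_ (continuousOn_pi.1 hψ' j)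
    exact continuousOn_pi.1 (continuousOn_pi.1 hN i) j

/-- The definition uses the preferred chart at each point, which may jump; chart independence allows
the chart at `x₀` to be used throughout its domain. -/
theorem continuous_gradInner (g : Metric n X) {φ ψ : X → ℂ} (hφ : Smooth (n := n) φ)
    (hψ : Smooth (n := n) ψ) : Continuous (gradInner g φ ψ) := by
  rw [continuous_iff_continuousAt]
  intro x₀
  have hloc : (fun x => gradIn g x₀ φ ψ (chart x₀ x)) =ᶠ[𝓝 x₀] gradInner g φ ψ := by
    filter_upwards [(chart x₀).open_source.mem_nhds (mem_chart_source _ x₀)] with x hx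
    have hx' : (chart x₀).symm (chart x₀ x) = x := (chart x₀).left_inv hx
    rw [gradInner_eq_gradIn, gradIn_transition g hφ hψ (x₁ := x) ((chart x₀).map_source hx)
      (by rw [hx']; exact mem_chart_source _ x), transition, hx']
  refine ContinuousAt.congr ?_ hloc
  exact ContinuousAt.comp (g := gradIn g x₀ φ ψ) (f := chart x₀)
    ((continuousOn_gradIn g hφ hψ x₀).continuousAt
      ((chart x₀).open_target.mem_nhds (mem_chart_target _ x₀)))
    ((chart x₀).continuousAt (mem_chart_source _ x₀))

theorem Smooth.partialIn_add {φ ψ : X → ℂ} (hφ : Smooth (n := n) φ) (hψ : Smooth (n := n) ψ)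
    {x₀ : X} {y : EuclideanSpace ℝ (Fin n)} (hy : y ∈ (chart x₀).target) :
    partialIn x₀ (φ + ψ) y = partialIn x₀ φ y + partialIn x₀ ψ y := by
  ext i
  have : (φ + ψ) ∘ (chart x₀).symm = φ ∘ (chart x₀).symm + ψ ∘ (chart x₀).symm := rfl
  rw [partialIn, this, fderiv_add (hφ.differentiableAt hy) (hψ.differentiableAt hy)]
  rfl

theorem Smooth.partialIn_smul {φ : X → ℂ} (hφ : Smooth (n := n) φ) (c : ℂ)
    {x₀ : X} {y : EuclideanSpace ℝ (Fin n)} (hy : y ∈ (chart x₀).target) :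
    partialIn x₀ (c • φ) y = c • partialIn x₀ φ y := by
  ext i
  have : (c • φ) ∘ (chart x₀).symm = c • (φ ∘ (chart x₀).symm) := rfl
  rw [partialIn, this, fderiv_const_smul (hφ.differentiableAt hy)]
  rfl

theorem gradInner_add_left (g : Metric n X) {φ φ' : X → ℂ} (hφ : Smooth (n := n) φ)
    (hφ' : Smooth (n := n) φ') (ψ : X → ℂ) (x : X) :
    gradInner g (φ + φ') ψ x = gradInner g φ ψ x + gradInner g φ' ψ x := by
  simp only [gradInner_eq_gradIn, gradIn, hφ.partialIn_add hφ' (mem_chart_target _ x), star_add,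
    add_dotProduct]

theorem gradInner_smul_left (g : Metric n X) {φ : X → ℂ} (hφ : Smooth (n := n) φ)
    (c : ℂ) (ψ : X → ℂ) (x : X) :
    gradInner g (c • φ) ψ x = starRingEnd ℂ c * gradInner g φ ψ x := by
  simp only [gradInner_eq_gradIn, gradIn, hφ.partialIn_smul c (mem_chart_target _ x), star_smul,
    smul_dotProduct, smul_eq_mul, starRingEnd_apply]

theorem conj_gradInner (g : Metric n X) (φ ψ : X → ℂ) (x : X) :
    starRingEnd ℂ (gradInner g ψ φ x) = gradInner g φ ψ x := by
  have hH : (metricMatrix g x (chart x x))⁻¹.IsHermitian :=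
    (posDef_metricMatrix g (mem_chart_target _ x)).inv.isHermitian
  have hN : (cometric g x (chart x x)).conjTranspose = cometric g x (chart x x) := by
    ext i j
    have := hH.apply i j
    simp only [star_trivial] at this
    simp [cometric, this]
  rw [gradInner_eq_gradIn, gradInner_eq_gradIn, gradIn, gradIn, starRingEnd_apply,
    ← Matrix.star_dotProduct_star, star_star, Matrix.star_mulVec, hN, ← Matrix.dotProduct_mulVec]

/-- The cometric is real, so the real and imaginary parts of the differential contribute separately.
-/
theorem re_gradInner_nonneg (g : Metric n X) (φ : X → ℂ) (x : X) :
    0 ≤ (gradInner g φ φ x).re := by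
  have hP : (metricMatrix g x (chart x x))⁻¹.PosSemidef :=
    (posDef_metricMatrix g (mem_chart_target _ x)).inv.posSemidef
  have h1 := hP.dotProduct_mulVec_nonneg fun i => (partialDeriv φ x i).re
  have h2 := hP.dotProduct_mulVec_nonneg fun i => (partialDeriv φ x i).im
  refine (add_nonneg h1 h2).trans_eq ?_
  simp only [gradInner, dotProduct, Matrix.mulVec, Finset.mul_sum, ← Finset.sum_add_distrib,
    Complex.re_sum, star_trivial, Pi.star_apply]
  refine Finset.sum_congr rfl fun i _ => Finset.sum_congr rfl fun j _ => ?_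
  simp only [Complex.mul_re, Complex.conj_re, Complex.conj_im, Complex.ofReal_re,
    Complex.ofReal_im, zero_mul, sub_zero]
  ring

end Gradient

/-! ### The Laplace–Beltrami operator and transfer of the abstract results -/

section Laplacian

variable {n : ℕ} {X : Type*} [TopologicalSpace X] [ChartedSpace (EuclideanSpace ℝ (Fin n)) X]

variable (n X) in
/-- The space of smooth complex-valued functions. -/
def smoothFunctions : Submodule ℂ (X → ℂ) where
  carrier := {φ | Smooth (n := n) φ}
  add_mem' h h' := ContMDiff.add h h'
  zero_mem' := contMDiff_const
  smul_mem' c _ h := by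
    have h2 : ContDiff ℝ ∞ fun z : ℂ => c * z := contDiff_const.mul contDiff_id
    exact h2.contMDiff.comp h

variable [IsManifold (𝓡 n) ∞ X] [MeasurableSpace X]

theorem isSolution_iff (g : Metric n X) (T : ℝ) (F : ℝ → L2 g) (u₀ : L2 g) (u : ℝ → L2 g) :
    IsSolution g T F u₀ u ↔ IsWeakSolution (IsLaplacian g) T F u₀ u :=
  ⟨fun h => ⟨h.1, h.2, h.3⟩, fun h => ⟨h.1, h.2, h.3⟩⟩

variable [BorelSpace X]

theorem coeFn_restr (g : Metric n X) (U : TopologicalSpace.Opens X) (u : L2 g) :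
    restr g U u =ᵐ[riemVolume g] (U : Set X).indicator u :=
  MemLp.coeFn_toLp _

theorem norm_restr_le (g : Metric n X) (U : TopologicalSpace.Opens X) (u : L2 g) :
    ‖restr g U u‖ ≤ ‖u‖ := by
  refine Lp.norm_le_norm_of_ae_le ?_
  filter_upwards [coeFn_restr g U u] with x hx
  rw [hx]
  exact norm_indicator_le_norm_self _ _

/-- Multiplication by the indicator function of `U`, as a bounded operator. -/
noncomputable def restrCLM (g : Metric n X) (U : TopologicalSpace.Opens X) : L2 g →L[ℂ] L2 g :=
  LinearMap.mkContinuous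
    { toFun := restr g U
      map_add' := fun u v => by
        refine Lp.ext ?_
        filter_upwards [coeFn_restr g U (u + v), coeFn_restr g U u, coeFn_restr g U v,
          Lp.coeFn_add u v, Lp.coeFn_add (restr g U u) (restr g U v)] with x h1 h2 h3 h4 h5
        rw [h1, h5, Pi.add_apply, h2, h3]
        by_cases hx : x ∈ (U : Set X)
        · rw [indicator_of_mem hx, indicator_of_mem hx, indicator_of_mem hx, h4, Pi.add_apply]
        · rw [indicator_of_notMem hx, indicator_of_notMem hx, indicator_of_notMem hx, add_zero]
      map_smul' := fun c u => by
        refine Lp.ext ?_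
        filter_upwards [coeFn_restr g U (c • u), coeFn_restr g U u,
          Lp.coeFn_smul c u, Lp.coeFn_smul c (restr g U u)] with x h1 h2 h3 h4
        rw [h1, RingHom.id_apply, h4, Pi.smul_apply, h2]
        by_cases hx : x ∈ (U : Set X) <;> simp [hx, h3] } 1
    (fun u => by rw [one_mul]; exact norm_restr_le g U u)

theorem restrCLM_apply (g : Metric n X) (U : TopologicalSpace.Opens X) (u : L2 g) :
    restrCLM g U u = restr g U u :=
  rfl

theorem inner_restrCLM (g : Metric n X) (U : TopologicalSpace.Opens X) (u v : L2 g) :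
    inner ℂ (restrCLM g U u) v = inner ℂ u (restrCLM g U v) := by
  rw [L2.inner_def, L2.inner_def]
  refine integral_congr_ae ?_
  filter_upwards [coeFn_restr g U u, coeFn_restr g U v] with x h1 h2
  rw [restrCLM_apply, restrCLM_apply, h1, h2]
  by_cases hx : x ∈ (U : Set X) <;> simp [hx]

variable [CompactSpace X] [T2Space X]

theorem memLp_of_continuous (g : Metric n X) {φ : X → ℂ} (hφ : Continuous φ) (p : ℝ≥0∞) :
    MemLp φ p (riemVolume g) := by
  obtain ⟨C, hC⟩ := isCompact_univ.exists_bound_of_continuousOn hφ.continuousOn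
  exact MemLp.of_bound hφ.aestronglyMeasurable C (Eventually.of_forall fun x => hC x (mem_univ x))

theorem integrable_gradInner (g : Metric n X) {φ ψ : X → ℂ} (hφ : Smooth (n := n) φ)
    (hψ : Smooth (n := n) ψ) : Integrable (gradInner g φ ψ) (riemVolume g) :=
  memLp_one_iff_integrable.1 (memLp_of_continuous g (continuous_gradInner g hφ hψ) 1)

/-- The Dirichlet form, as a positive semidefinite form on smooth functions. -/
@[reducible]
noncomputable def dirichletCore (g : Metric n X) :
    PreInnerProductSpace.Core ℂ (smoothFunctions n X) where
  inner φ ψ := dirichlet g φ ψ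
  conj_inner_symm φ ψ := by
    simp only [dirichlet]
    rw [← integral_conj]
    simp only [conj_gradInner]
  re_inner_nonneg φ := by
    change 0 ≤ (dirichlet g φ φ).re
    have h := (Complex.reCLM).integral_comp_comm (integrable_gradInner g φ.2 φ.2)
    simp only [Complex.reCLM_apply] at h
    rw [dirichlet, ← h]
    exact integral_nonneg fun x => re_gradInner_nonneg g φ x
  add_left φ φ' ψ := by
    simp only [dirichlet]
    rw [← integral_add (integrable_gradInner g φ.2 ψ.2) (integrable_gradInner g φ'.2 ψ.2)]
    refine integral_congr_ae (Eventually.of_forall fun x => ?_)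
    exact gradInner_add_left g φ.2 φ'.2 ψ x
  smul_left φ ψ c := by
    simp only [dirichlet]
    rw [← integral_const_mul]
    refine integral_congr_ae (Eventually.of_forall fun x => ?_)
    exact gradInner_smul_left g φ.2 c ψ x

/-- The inclusion of smooth functions in `L²(X)`. -/
noncomputable def smoothToL2 (g : Metric n X) : smoothFunctions n X →ₗ[ℂ] L2 g where
  toFun φ := (memLp_of_continuous g φ.2.continuous 2).toLp φ
  map_add' _ _ := MemLp.toLp_add _ _
  map_smul' _ _ := MemLp.toLp_const_smul _ _

theorem coeFn_smoothToL2 (g : Metric n X) (φ : smoothFunctions n X) :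
    smoothToL2 g φ =ᵐ[riemVolume g] φ :=
  (memLp_of_continuous g φ.2.continuous 2).coeFn_toLp

theorem inner_smoothToL2 (g : Metric n X) (φ : smoothFunctions n X) (f : L2 g) :
    inner ℂ (smoothToL2 g φ) f =
      ∫ x, starRingEnd ℂ ((φ : X → ℂ) x) * f x ∂(riemVolume g) := by
  rw [L2.inner_def]
  refine integral_congr_ae ?_
  filter_upwards [coeFn_smoothToL2 g φ] with x hx
  rw [hx, RCLike.inner_apply, mul_comm]

theorem tendsto_smoothToL2_iff (g : Metric n X) (φ : ℕ → smoothFunctions n X) (u : L2 g) :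
    Tendsto (fun k => smoothToL2 g (φ k)) atTop (𝓝 u) ↔
      Tendsto (fun k => eLpNorm (fun x => (φ k : X → ℂ) x - u x) 2 (riemVolume g)) atTop (𝓝 0) := by
  rw [Lp.tendsto_Lp_iff_tendsto_eLpNorm']
  refine tendsto_congr fun k => eLpNorm_congr_ae ?_
  filter_upwards [coeFn_smoothToL2 g (φ k)] with x hx
  simp only [Pi.sub_apply, hx]

theorem isLaplacian_iff (g : Metric n X) (u f : L2 g) :
    IsLaplacian g u f ↔ FormGraph (dirichletCore g) (smoothToL2 g) u f := by
  constructor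
  · rintro ⟨φ, h0, h1, h2, h3⟩
    refine ⟨fun k => ⟨φ k, h0 k⟩, (tendsto_smoothToL2_iff g _ u).2 h1, h2, fun ψ => ?_⟩
    rw [inner_smoothToL2]
    exact h3 ψ ψ.2
  · rintro ⟨φ, h1, h2, h3⟩
    refine ⟨fun k => φ k, fun k => (φ k).2, (tendsto_smoothToL2_iff g _ u).1 h1, h2,
      fun ψ hψ => ?_⟩
    have := h3 ⟨ψ, hψ⟩
    rw [inner_smoothToL2] at this
    exact this

/-- Real smooth test functions already detect an integrable function; this is the density hypothesis
of `nonposSelfAdjoint_formGraph`. -/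
theorem eq_zero_of_inner_smoothToL2 (g : Metric n X) (f : L2 g)
    (h : ∀ ψ, inner ℂ (smoothToL2 g ψ) f = 0) : f = 0 := by
  have hint : Integrable f (riemVolume g) := (Lp.memLp f).integrable (by norm_num)
  rw [Lp.eq_zero_iff_ae_eq_zero]
  refine ae_eq_zero_of_integral_contMDiff_smul_eq_zero (𝓡 n) hint.locallyIntegrable
    fun ρ hρ _ => ?_
  have hρ' : Smooth (n := n) fun x => ((ρ x : ℝ) : ℂ) :=
    (Complex.ofRealCLM.contDiff.contMDiff).comp hρ
  have := h ⟨_, hρ'⟩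
  rw [inner_smoothToL2] at this
  simpa [Complex.real_smul] using this

/-- The Laplace-Beltrami operator is a nonpositive self-adjoint operator. -/
theorem nonposSelfAdjoint_isLaplacian (g : Metric n X) : NonposSelfAdjoint (IsLaplacian g) := by
  have h : IsLaplacian g = FormGraph (dirichletCore g) (smoothToL2 g) := by
    funext u f
    exact propext (isLaplacian_iff g u f)
  rw [h]
  exact nonposSelfAdjoint_formGraph _ _ (eq_zero_of_inner_smoothToL2 g)

theorem separableSpace_L2 (g : Metric n X) : SeparableSpace (L2 g) := by
  have := ChartedSpace.secondCountable_of_sigmaCompact (EuclideanSpace ℝ (Fin n)) X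
  have : Fact ((2 : ℝ≥0∞) ≠ ⊤) := ⟨by norm_num⟩
  have : SecondCountableTopology (L2 g) := Lp.SecondCountableTopology
  infer_instance

variable {g : Metric n X} {U : TopologicalSpace.Opens X}

/-- Existence of the weak solution gives one direction, its uniqueness the other. -/
theorem observable_iff {S : ℝ → L2 g →L[ℂ] L2 g} (hS : IsFlow (IsLaplacian g) S) {T C : ℝ}
    (hT : 0 ≤ T) : Observable g U T C ↔
      ∀ x : L2 g, ‖x‖ ^ 2 ≤ C * ∫ t in (0 : ℝ)..T, ‖restrCLM g U (S t x)‖ ^ 2 := by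
  constructor
  · intro h x
    refine h x _ ((isSolution_iff g T _ x _).2 ?_)
    simpa using hS.isWeakSolution T (F := fun _ => 0) continuous_const x
  · intro h x v hv
    refine (h x).trans_eq ?_
    congr 1
    refine intervalIntegral.integral_congr fun t ht => ?_
    rw [uIcc_of_le hT] at ht
    simp only [hS.eq_of_isWeakSolution (nonposSelfAdjoint_isLaplacian g)
      ((isSolution_iff g T _ x v).1 hv) ht, restrCLM_apply]

theorem observable_of_resolventEstimate {M m : ℝ} (hM : 0 < M) (hm : 0 < m)
    (h : ResolventEstimate g U M m) {T : ℝ} (hT : Real.pi * Real.sqrt M < T) :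
    Observable g U T (2 * m * T / (T ^ 2 - M * Real.pi ^ 2)) := by
  have hA := nonposSelfAdjoint_isLaplacian g
  obtain ⟨S, hS⟩ := hA.exists_isFlow
  have hsep := separableSpace_L2 g
  rw [observable_iff hS (lt_of_le_of_lt (by positivity) hT).le]
  exact hS.observable_of_resolventEstimate (P := restrCLM g U) hA hM hm
    (fun l u f huf => h l u f huf) hT

theorem exactlyControllable_of_observable {T C : ℝ} (hT : 0 < T) (h : Observable g U T C)
    (p : ℝ≥0∞) : ExactlyControllable g U p T := by
  intro u₀ u₁
  obtain ⟨S, hS⟩ := (nonposSelfAdjoint_isLaplacian g).exists_isFlow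
  obtain ⟨c, hc, u, hu, hu1⟩ := hS.exists_control (inner_restrCLM g U) hT
    ((observable_iff hS hT.le).1 h) u₀ u₁
  refine ⟨c, ?_, u, (isSolution_iff g T _ u₀ u).2 hu, hu1⟩
  obtain ⟨B, hB⟩ := isCompact_Icc.exists_bound_of_continuousOn (hc.continuousOn (s := Icc 0 T))
  exact MemLp.of_bound hc.aestronglyMeasurable B
    ((ae_restrict_iff' measurableSet_Icc).2 (Eventually.of_forall hB))

theorem exists_resolventEstimate_of_exactlyControllable {p : ℝ≥0∞} (hp : 1 ≤ p) {T : ℝ}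
    (hT : 0 < T) (h : ExactlyControllable g U p T) :
    ∃ C : ℝ, 0 < C ∧ ResolventEstimate g U C C := by
  refine exists_resolventEstimate_of_controllable (P := restrCLM g U)
    (nonposSelfAdjoint_isLaplacian g) (inner_restrCLM g U) hT fun u₁ => ?_
  obtain ⟨c, hc, u, hu, hu1⟩ := h 0 u₁
  refine ⟨c, ?_, u, (isSolution_iff g T _ 0 u).1 hu, hu1⟩
  rw [intervalIntegrable_iff_integrableOn_Icc_of_le hT.le]
  -- On a bounded interval `L^p` lies in `L¹` for every `p ≥ 1`, including `p = ∞`.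
  exact hc.integrable hp

theorem resolventEstimate_of_observable {T C : ℝ} (hT : 0 < T) (h : Observable g U T C) :
    ResolventEstimate g U (2 * C * T ^ 3 / 3) (2 * C * T) := by
  obtain ⟨S, hS⟩ := (nonposSelfAdjoint_isLaplacian g).exists_isFlow
  intro l u f huf
  exact hS.resolventEstimate_of_observable (P := restrCLM g U) (norm_restr_le g U) hT
    ((observable_iff hS hT.le).1 h) l huf

end Laplacian

end Schrodinger

theorem theorem4p1 {n : ℕ} {X : Type*} [TopologicalSpace X]
    [ChartedSpace (EuclideanSpace ℝ (Fin n)) X] [IsManifold (𝓡 n) ∞ X]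
    [CompactSpace X] [T2Space X] [MeasurableSpace X] [BorelSpace X]
    (g : Schrodinger.Metric n X) (U : TopologicalSpace.Opens X) :
    (∀ p : ℝ≥0∞, 1 ≤ p →
      ((∃ T : ℝ, 0 < T ∧ Schrodinger.ExactlyControllable g U p T) ↔
        ∃ M m : ℝ, 0 < M ∧ 0 < m ∧ Schrodinger.ResolventEstimate g U M m)) ∧
    (∀ M m : ℝ, 0 < M → 0 < m → Schrodinger.ResolventEstimate g U M m →
      ∀ T : ℝ, Real.pi * Real.sqrt M < T →
        Schrodinger.Observable g U T (2 * m * T / (T ^ 2 - M * Real.pi ^ 2)) ∧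
        ∀ p : ℝ≥0∞, 1 ≤ p → Schrodinger.ExactlyControllable g U p T) ∧
    (∀ T C : ℝ, 0 < T → Schrodinger.Observable g U T C →
      Schrodinger.ResolventEstimate g U (2 * C * T ^ 3 / 3) (2 * C * T)) := by
  refine ⟨fun p hp => ⟨?_, ?_⟩, fun M m hM hm h T hT => ?_, fun T C hT h =>
    Schrodinger.resolventEstimate_of_observable hT h⟩
  · rintro ⟨T, hT, h⟩
    obtain ⟨C, hC, hres⟩ :=
      Schrodinger.exists_resolventEstimate_of_exactlyControllable hp hT h
    exact ⟨C, C, hC, hC, hres⟩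
  · rintro ⟨M, m, hM, hm, h⟩
    -- Any time beyond the threshold `π √M` serves.
    exact ⟨Real.pi * Real.sqrt M + 1, by positivity,
      Schrodinger.exactlyControllable_of_observable (by positivity)
        (Schrodinger.observable_of_resolventEstimate hM hm h (lt_add_one _)) p⟩
  · have hobs := Schrodinger.observable_of_resolventEstimate hM hm h hT
    exact ⟨hobs, fun p _ => Schrodinger.exactlyControllable_of_observable
      (lt_of_le_of_lt (by positivity) hT) hobs p⟩
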